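/- Let $1\le p\le 2$ and $1/p+1/p'=1$ ($p'=\infty$ if $p=1$). Functions are complex valued. Consider the following two cases. (H) Harmonic translation and cosine transform: $I=(0,\infty)$, and functions on $I$ are identified with their even extensions to $\mathbb{R}$. For $t>0$ let $$T^tf(x)=\frac1\pi\int_{\mathbb{R}} f(\xi)\frac{t}{(\xi-x)^2+t^2}\,d\xi ,$$ let $k(u)=\cos u$, and let $\nu$ be either of the measures $dt$ and $\sqrt t\,dt$ on $(0,\infty)$. (P) Heat translation and Fourier transform: $I=\mathbb{R}$, $b>0$ is fixed, and for $t>0$ let $$T^tf(x)=\int_{\mathbb{R}} f(\xi)\frac{e^{-(x-\xi)^2/(4b^2t)}}{2b\sqrt{\pi t}}\,d\xi ,$$ let $k(u)=e^{-iu}$, and let $d\nu(t)=dt$ on $(0,\infty)$. In both cases $T^0f=f$. For $f\in L^p(I)$ let $\hat f$ be the transform $\hat f(z)=\int_{\mathbb{R}}f(x)k(xz)\,dx$, understood as the limit in $L^{p'}(I)$ of $\int_{-N}^{N}f(x)k(xz)\,dx$ as $N\to\infty$; this limit exists for every $f\in L^p(I)$. For $K\subset L^p(I)$ put $\hat K=\{\hat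 f: f\in K\}\subset L^{p'}(I)$. For $a,R>0$ let $$M_{a,R}f(x)=\frac{1}{\nu((0,a))}\int_{(0,a)}T^tf(x)\,d\nu(t)\quad (|x|<R),\qquad M_{a,R}f(x)=0\quad (|x|\ge R).$$ For a set $K\subset L^r(I)$, $1\le r\le\infty$, define the following properties. $\mathbf{P_a}$ ($K$ is equivanishing): for every $\varepsilon>0$ there is an $R>0$ such that $\|f\|_{L^r(I\setminus[-R,R])}<\varepsilon$ for all $f\in K$. $\mathbf{P_{b_1}}$: for all $\varepsilon,M_0>0$ there is a $\delta>0$ such that $\|T^{t+h}f-T^tf\|_{L^r(I)}<\varepsilon$ for all $0\le t<M_0$, all real $h$ with $|h|\le\delta$ and $t+h\ge0$, and all $f\in K$. $\mathbf{P_{b_2}}$: for all $\varepsilon,a,R>0$ there is a $\delta>0$ such that $|M_{a,R}f(x+h)-M_{a,R}f(x)|<\varepsilon$ for all real $h$ with $|h|\le\delta$, all $f\in K$, and all $x,x+h\in I$ with $|x|<R$, $|x+h|<R$. Theorem. In each of the cases (H) and (P), let $K\subset L^p(I)$ be bounded. If $K$ satisfies $\mathbf{P_a}$, then $\hat K$ satisfies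 $\mathbf{P_{b_1}}$ and $\mathbf{P_{b_2}}$. Conversely, if $K$ satisfies $\mathbf{P_{b_1}}$, then $\hat K$ satisfies $\mathbf{P_a}$. -/

import Mathlib

open MeasureTheory Set Filter Topology
open scoped ENNReal

namespace Pego

/-- Harmonic (Poisson) translation on the upper half-plane, with `T^0 f = f`:
`T^t f (x) = (1/π) ∫ f(ξ) t / ((ξ - x)^2 + t^2) dξ` for `t > 0`. -/
noncomputable def harmonicTranslation (t : ℝ) (f : ℝ → ℂ) (x : ℝ) : ℂ :=
  if t = 0 then f x
  else ∫ ξ : ℝ, ((1 / Real.pi * (t / ((ξ - x) ^ 2 + t ^ 2)) : ℝ) : ℂ) * f ξ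

/-- Heat translation for `u_t = b^2 u_xx`, with `T^0 f = f`. -/
noncomputable def heatTranslation (b t : ℝ) (f : ℝ → ℂ) (x : ℝ) : ℂ :=
  if t = 0 then f x
  else ∫ ξ : ℝ,
    ((Real.exp (-(x - ξ) ^ 2 / (4 * b ^ 2 * t)) /
      (2 * b * Real.sqrt Real.pi * Real.sqrt t) : ℝ) : ℂ) * f ξ

/-- The even function on the line that extends a function on `(0, ∞)`. -/
def evenExt (f : ℝ → ℂ) (x : ℝ) : ℂ := f |x|

/-- Harmonic translation of a function on `(0, ∞)`, extended evenly. -/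
noncomputable def evenHarmonicTranslation (t : ℝ) (f : ℝ → ℂ) : ℝ → ℂ :=
  harmonicTranslation t (evenExt f)

/-- `F ∈ L^q(μ)` is the integral transform `∫ f(x) k(xz) dx` of `f`, understood as the limit in
`L^q(μ)` of the truncated integrals over `(-N, N)`, as `N → ∞`. -/
def IsTransform (k : ℝ → ℂ) (q : ℝ≥0∞) (μ : Measure ℝ) (f : ℝ → ℂ) (F : Lp ℂ q μ) : Prop :=
  Tendsto (fun N : ℝ => eLpNorm (fun z : ℝ => F z - ∫ x in (-N)..N, f x * k (x * z)) q μ)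
    atTop (𝓝 0)

/-- Lebesgue measure on `(0, ∞)`. -/
noncomputable abbrev halfLine : Measure ℝ := volume.restrict (Ioi 0)

/-- `F ∈ L^q(0,∞)` is the cosine transform of `f ∈ L^p(0,∞)` (kernel `cos`, `f` extended evenly). -/
def IsCosineTransform {p q : ℝ≥0∞} (f : Lp ℂ p halfLine) (F : Lp ℂ q halfLine) : Prop :=
  IsTransform (fun u => (Real.cos u : ℂ)) q halfLine (evenExt f) F

/-- `F ∈ L^q(ℝ)` is the Fourier transform of `f ∈ L^p(ℝ)` (kernel `exp(-i u)`). -/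
def IsFourierTransform {p q : ℝ≥0∞} (f : Lp ℂ p (volume : Measure ℝ))
    (F : Lp ℂ q (volume : Measure ℝ)) : Prop :=
  IsTransform (fun u => Complex.exp (-(Complex.I * u))) q volume f F

/-- The set of cosine transforms of the members of `K`. -/
def cosineImage {p : ℝ≥0∞} (q : ℝ≥0∞) (K : Set (Lp ℂ p halfLine)) : Set (Lp ℂ q halfLine) :=
  {F | ∃ f ∈ K, IsCosineTransform f F}

/-- The set of Fourier transforms of the members of `K`. -/
def fourierImage {p : ℝ≥0∞} (q : ℝ≥0∞) (K : Set (Lp ℂ p (volume : Measure ℝ))) :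
    Set (Lp ℂ q (volume : Measure ℝ)) :=
  {F | ∃ f ∈ K, IsFourierTransform f F}

/-- Property `P_a`. -/
def Equivanishing {p : ℝ≥0∞} {μ : Measure ℝ} (K : Set (Lp ℂ p μ)) : Prop :=
  ∀ ε : ℝ, 0 < ε → ∃ R : ℝ, 0 < R ∧ ∀ f ∈ K,
    eLpNorm f p (μ.restrict {x | R < |x|}) < ENNReal.ofReal ε

/-- Property `P_{b1}` for the translation `T`. The parameters `t` and `t + h` range over
`[0, ∞)`. -/
def PropB1 (T : ℝ → (ℝ → ℂ) → ℝ → ℂ) {p : ℝ≥0∞} {μ : Measure ℝ} (K : Set (Lp ℂ p μ)) : Prop :=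
  ∀ ε : ℝ, 0 < ε → ∀ M : ℝ, 0 < M → ∃ δ : ℝ, 0 < δ ∧
    ∀ t : ℝ, 0 ≤ t → t < M → ∀ h : ℝ, |h| ≤ δ → 0 ≤ t + h → ∀ f ∈ K,
      eLpNorm (fun x => T (t + h) f x - T t f x) p μ < ENNReal.ofReal ε

/-- The mean `M_{a,R} f` of the translates of `f` over `0 < t < a`, with respect to `ν`,
cut off outside `|x| < R`. -/
noncomputable def translationMean (T : ℝ → (ℝ → ℂ) → ℝ → ℂ) (ν : Measure ℝ) (a R : ℝ)
    (f : ℝ → ℂ) (x : ℝ) : ℂ :=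
  if |x| < R then (((ν (Ioo 0 a)).toReal : ℂ))⁻¹ * ∫ t in Ioo 0 a, T t f x ∂ν else 0

/-- Property `P_{b2}` for the translation `T` of functions on `D`, with averaging measure `ν`. -/
def PropB2 (T : ℝ → (ℝ → ℂ) → ℝ → ℂ) (ν : Measure ℝ) (D : Set ℝ) {p : ℝ≥0∞} {μ : Measure ℝ}
    (K : Set (Lp ℂ p μ)) : Prop :=
  ∀ a : ℝ, 0 < a → ∀ R : ℝ, 0 < R → ∀ ε : ℝ, 0 < ε → ∃ δ : ℝ, 0 < δ ∧
    ∀ h : ℝ, |h| ≤ δ → ∀ f ∈ K, ∀ x ∈ D, x + h ∈ D → |x| < R → |x + h| < R →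
      ‖translationMean T ν a R f (x + h) - translationMean T ν a R f x‖ < ε

/-- The measure `√t dt` on `(0, ∞)`. -/
noncomputable def sqrtMeasure : Measure ℝ :=
  volume.withDensity fun t => ENNReal.ofReal (Real.sqrt t)

end Pego

open MeasureTheory Set Filter Topology
open scoped ENNReal

namespace Pego

/-! The Fourier transform turns both translations into multiplication: if `F` is the transform of
`f`, then `T^t F` is the transform of `m t * f`, with `m t x = exp (-(t * |x|))` for the Poisson
kernel and `exp (-(b ^ 2 * t * x ^ 2))` for the heat kernel. Each property of translates of `F` thus
becomes a property of a multiplier acting on `f`, and conversely. `IsTranslationKernel` collects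
what is needed of a kernel and its multiplier, so that one argument serves both cases.

Suppose `K` is bounded and equivanishing. By Hausdorff–Young, the `L^q` norm of `T^s F - T^t F` is
at most `C` times the `L^p` norm of `(m s - m t) * f`. This is small because `m s - m t` is small on
bounded sets (`mult_lipschitz`) and bounded everywhere, while the tails of `f` are uniformly small.
For the means, `T^t F` is given at every point by an absolutely convergent integral. Hölder bounds
its increment by the `L^q` norm of `m t`, at most `A * (1 + t ^ (-1/2))` by `mult_sq`, times the
`L^p` norm of `f` multiplied by a difference of exponentials. The first factor is integrable near `t
= 0` for both measures; the second is small, again by equivanishing.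

Conversely, `(m t - 1) * F` is the transform of `T^t f - f`, so its `L^q` norm is at most `C` times
the `L^p` norm of `T^t f - f`. For one fixed small `t`, `m t` is at most `1/2` far out
(`mult_decay`), where `F` is therefore dominated by `2 * |(m t - 1) * F|`.

Hausdorff–Young is obtained with a non-sharp constant by real interpolation between the `L¹`–`L^∞`
bound and Plancherel. The half-line case reduces to the line by even extension, at the cost of
factors 2. -/

open FourierTransform SchwartzMap in
/-- Plancherel's theorem on `L¹ ∩ L²`, in Mathlib's normalization. -/
theorem eLpNorm_fourier_eq {f : ℝ → ℂ} (hf : Integrable f) (hf2 : MemLp f 2) :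
    eLpNorm (𝓕 f) 2 = eLpNorm f 2 := by
  have hcont : Continuous (𝓕 f) :=
    VectorFourier.fourierIntegral_continuous Real.continuous_fourierChar
      (by fun_prop) hf
  -- The integral transform and the `L²` transform agree a.e. since they have the same integrals
  -- against test functions: on one side by duality of tempered distributions, on the other by
  -- Fubini.
  have key : ∀ᵐ x, 𝓕 f x = (𝓕 (hf2.toLp f) : Lp ℂ 2 (volume : Measure ℝ)) x := by
    apply ae_eq_of_integral_contDiff_smul_eq hcont.locallyIntegrable
      ((Lp.memLp _).locallyIntegrable (by norm_num))
    intro g hg hgc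
    have hgc' : HasCompactSupport (fun x => (g x : ℂ)) := hgc.comp_left (g := Complex.ofReal) rfl
    have hg' : ContDiff ℝ (↑(⊤ : ℕ∞)) (fun x => (g x : ℂ)) :=
      Complex.ofRealCLM.contDiff.comp hg
    set φ : 𝓢(ℝ, ℂ) := hgc'.toSchwartzMap hg' with hφ
    have hφx : ∀ x, φ x = g x := fun x => rfl
    have h1 := congrArg (fun T => T φ) (Lp.fourier_toTemperedDistribution_eq (hf2.toLp f))
    simp only [TemperedDistribution.fourier_apply, Lp.toTemperedDistribution_apply] at h1
    have h2 : ∫ x, (𝓕 φ) x • (hf2.toLp f) x = ∫ x, (𝓕 φ) x • f x := by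
      apply integral_congr_ae
      filter_upwards [hf2.coeFn_toLp] with x hx
      rw [hx]
    have h3 := VectorFourier.integral_fourierIntegral_smul_eq_flip (L := innerₗ ℝ)
      Real.continuous_fourierChar (by fun_prop) (φ.integrable (μ := volume)) hf
    rw [h2] at h1
    have h4 : ∫ x, (𝓕 φ) x • f x = ∫ x, φ x • 𝓕 f x := by
      simp only [flip_innerₗ] at h3
      exact h3
    rw [h4] at h1
    simpa [hφx] using! h1
  rw [eLpNorm_congr_ae key]
  have := Lp.norm_fourier_eq (hf2.toLp f)
  rw [Lp.norm_def, Lp.norm_def, ENNReal.toReal_eq_toReal_iff' (Lp.eLpNorm_ne_top _)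
    (Lp.eLpNorm_ne_top _)] at this
  rw [this, eLpNorm_congr_ae hf2.coeFn_toLp]

/-! ### The transform with kernel `exp(-ixz)` -/

/-- The Fourier transform with kernel `exp(-i x z)`. -/
noncomputable def ft (f : ℝ → ℂ) (z : ℝ) : ℂ :=
  ∫ x, f x * Complex.exp (-(Complex.I * ((x * z : ℝ) : ℂ)))

theorem norm_kernel (u : ℝ) : ‖Complex.exp (-(Complex.I * (u : ℂ)))‖ = 1 := by
  rw [Complex.norm_exp]; simp

/-- Gives access to continuity and to the multiplication formula without a change of scale. -/
theorem ft_eq_vectorFourier (f : ℝ → ℂ) :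
    ft f = VectorFourier.fourierIntegral Real.probChar volume (LinearMap.mul ℝ ℝ) f := by
  ext z
  rw [VectorFourier.fourierIntegral_probChar, ft]
  congr 1; ext x
  rw [smul_eq_mul, mul_comm]
  congr 2
  simp; ring

/-- Carries Plancherel, inversion and the convolution theorem over from the normalization with `2π`
in the exponent. -/
theorem ft_eq_fourier (f : ℝ → ℂ) (z : ℝ) : ft f z = FourierTransform.fourier f (z * (2 * Real.pi)⁻¹) := by
  rw [Real.fourier_eq', ft]
  congr 1; ext x
  rw [smul_eq_mul, mul_comm]
  congr 2
  have : (Real.pi : ℂ) ≠ 0 := by exact_mod_cast Real.pi_ne_zero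
  simp
  field_simp

theorem continuous_ft {f : ℝ → ℂ} (hf : Integrable f) : Continuous (ft f) := by
  rw [ft_eq_vectorFourier]
  exact VectorFourier.fourierIntegral_continuous (by fun_prop) (by simp; fun_prop) hf

theorem enorm_ft_le (f : ℝ → ℂ) (z : ℝ) : ‖ft f z‖ₑ ≤ eLpNorm f 1 := by
  rw [eLpNorm_one_eq_lintegral_enorm]
  refine (enorm_integral_le_lintegral_enorm _).trans (le_of_eq ?_)
  congr 1; ext x
  rw [enorm_mul, ← ofReal_norm (Complex.exp _), norm_kernel]; simp

theorem ft_congr {f g : ℝ → ℂ} (h : f =ᵐ[volume] g) : ft f = ft g := by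
  ext z
  apply integral_congr_ae
  filter_upwards [h] with x hx
  rw [hx]

theorem integrable_mul_kernel {f : ℝ → ℂ} (hf : Integrable f) (z : ℝ) :
    Integrable fun x => f x * Complex.exp (-(Complex.I * ((x * z : ℝ) : ℂ))) := by
  refine hf.mul_bdd (c := 1) (by fun_prop) ?_
  filter_upwards with x
  rw [norm_kernel]

theorem ft_add {f g : ℝ → ℂ} (hf : Integrable f) (hg : Integrable g) :
    ft (f + g) = ft f + ft g := by
  ext z
  simp only [ft, Pi.add_apply, add_mul]
  exact integral_add (integrable_mul_kernel hf z) (integrable_mul_kernel hg z)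

theorem ft_sub {f g : ℝ → ℂ} (hf : Integrable f) (hg : Integrable g) :
    ft (f - g) = ft f - ft g := by
  ext z
  simp only [ft, Pi.sub_apply, sub_mul]
  exact integral_sub (integrable_mul_kernel hf z) (integrable_mul_kernel hg z)

theorem lintegral_enorm_ft_sq {f : ℝ → ℂ} (hf : Integrable f) (hf2 : MemLp f 2) :
    ∫⁻ z, ‖ft f z‖ₑ ^ 2 = ENNReal.ofReal (2 * Real.pi) * ∫⁻ x, ‖f x‖ₑ ^ 2 := by
  have h1 := eLpNorm_fourier_eq hf hf2
  have h2 : ∫⁻ z, ‖FourierTransform.fourier f z‖ₑ ^ 2 = ∫⁻ x, ‖f x‖ₑ ^ 2 := by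
    rw [eLpNorm_eq_lintegral_rpow_enorm_toReal (by norm_num) (by norm_num),
      eLpNorm_eq_lintegral_rpow_enorm_toReal (by norm_num) (by norm_num)] at h1
    have := ENNReal.rpow_left_injective (x := 1 / (2 : ℝ≥0∞).toReal) (by norm_num) h1
    simpa using this
  have hcont : Continuous (FourierTransform.fourier f) :=
    VectorFourier.fourierIntegral_continuous Real.continuous_fourierChar (by fun_prop) hf
  have h0 : (2 * Real.pi)⁻¹ ≠ 0 := by positivity
  simp_rw [ft_eq_fourier]
  rw [← h2, ← lintegral_map (μ := volume) (f := fun z => ‖FourierTransform.fourier f z‖ₑ ^ 2)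
    (g := fun z => z * (2 * Real.pi)⁻¹) (by fun_prop) (by fun_prop),
    Real.map_volume_mul_right h0, lintegral_smul_measure, inv_inv, abs_of_pos (by positivity)]
  rfl

/-! ### The Hausdorff–Young inequality -/

theorem lintegral_Ioi_indicator_rpow {b r : ℝ} (hb : 0 < b) (hr : 0 < r) :
    ∫⁻ α in Ioi 0, (Iic b).indicator (fun α => ENNReal.ofReal (α ^ (r - 1))) α =
      ENNReal.ofReal (b ^ r / r) := by
  rw [lintegral_indicator measurableSet_Iic, Measure.restrict_restrict measurableSet_Iic,
    Iic_inter_Ioi, ← ofReal_integral_eq_lintegral_ofReal]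
  · rw [← intervalIntegral.integral_of_le hb.le, integral_rpow (Or.inl (by linarith))]
    simp [hr.ne']
  · exact (intervalIntegral.intervalIntegrable_rpow' (by linarith)).1
  · filter_upwards [ae_restrict_mem measurableSet_Ioc] with x hx
    exact Real.rpow_nonneg hx.1.le _

/-- The distribution function of the Fourier transform, by splitting `f` at the height
where `α |f|^(p-1) = 2A`, with `A = ∫ |f|^p`. -/
theorem volume_lt_norm_ft_le {f : ℝ → ℂ} (hfm : Measurable f) (hf : Integrable f) {p A α : ℝ}
    (hp : 1 < p) (hA : 0 < A) (hfA : ∫⁻ x, ENNReal.ofReal (‖f x‖ ^ p) ≤ ENNReal.ofReal A)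
    (hα : 0 < α) :
    volume {z | α < ‖ft f z‖} ≤ ENNReal.ofReal (8 * Real.pi * α ^ (-2 : ℝ)) *
      ∫⁻ x, {x | α * ‖f x‖ ^ (p - 1) ≤ 2 * A}.indicator (fun x => ENNReal.ofReal (‖f x‖ ^ 2)) x := by
  set E := {x | α * ‖f x‖ ^ (p - 1) ≤ 2 * A} with hE
  have hEm : MeasurableSet E := measurableSet_le (by fun_prop) (by fun_prop)
  have hi1 : Integrable (E.indicator f) := hf.indicator hEm
  have hi2 : Integrable (Eᶜ.indicator f) := hf.indicator hEm.compl
  have hsum : ft f = ft (E.indicator f) + ft (Eᶜ.indicator f) := by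
    rw [← ft_add hi1 hi2, indicator_self_add_compl]
  have hp1 : 0 < p - 1 := by linarith
  -- the low part is bounded, hence square integrable
  have hbd : ∀ x, ‖E.indicator f x‖ ≤ (2 * A / α) ^ (1 / (p - 1)) := by
    intro x
    by_cases hx : x ∈ E
    · rw [indicator_of_mem hx]
      have : ‖f x‖ ^ (p - 1) ≤ 2 * A / α := by
        rw [le_div_iff₀ hα, mul_comm]; exact hx
      rw [one_div, Real.le_rpow_inv_iff_of_pos (norm_nonneg _) (by positivity) hp1]
      exact this
    · rw [indicator_of_notMem hx]; simp; positivity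
  have hmem2 : MemLp (E.indicator f) 2 := by
    rw [memLp_two_iff_integrable_sq_norm hi1.aestronglyMeasurable]
    simp_rw [pow_two]
    exact hi1.norm.mul_bdd hi1.norm.aestronglyMeasurable
      (Eventually.of_forall fun x => by rw [norm_norm]; exact hbd x)
  -- the high part has small `L¹` norm
  have hhigh : ∀ z, ‖ft (Eᶜ.indicator f) z‖ₑ ≤ ENNReal.ofReal (α / 2) := by
    intro z
    refine (enorm_ft_le _ z).trans ?_
    rw [eLpNorm_one_eq_lintegral_enorm]
    calc ∫⁻ x, ‖Eᶜ.indicator f x‖ₑ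
        ≤ ∫⁻ x, ENNReal.ofReal (α / (2 * A)) * ENNReal.ofReal (‖f x‖ ^ p) := by
          apply lintegral_mono
          intro x
          by_cases hx : x ∈ E
          · simp [hx]
          · beta_reduce
            rw [indicator_of_mem (show x ∈ Eᶜ from hx), ← ENNReal.ofReal_mul (by positivity),
              ← ofReal_norm]
            apply ENNReal.ofReal_le_ofReal
            have hx' : 2 * A < α * ‖f x‖ ^ (p - 1) := not_le.1 hx
            rcases (norm_nonneg (f x)).eq_or_lt with h0 | h0
            · rw [← h0]; positivity
            · have : ‖f x‖ ^ p = ‖f x‖ ^ (p - 1) * ‖f x‖ := by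
                rw [← Real.rpow_add_one h0.ne']; ring_nf
              rw [this, div_mul_eq_mul_div, le_div_iff₀ (by positivity)]
              nlinarith
      _ = ENNReal.ofReal (α / (2 * A)) * ∫⁻ x, ENNReal.ofReal (‖f x‖ ^ p) :=
          lintegral_const_mul _ (by fun_prop)
      _ ≤ ENNReal.ofReal (α / (2 * A)) * ENNReal.ofReal A := by gcongr
      _ = ENNReal.ofReal (α / 2) := by
          rw [← ENNReal.ofReal_mul (by positivity)]
          congr 1; field_simp
  -- The high part contributes at most `α / 2`, so the low part must exceed `α / 2`. Chebyshev and
  -- Plancherel then give the constant `8π = 4 · 2π`.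
  have hsub : {z | α < ‖ft f z‖} ⊆ {z | ENNReal.ofReal (α ^ 2 / 4) ≤ ‖ft (E.indicator f) z‖ₑ ^ 2} := by
    intro z hz
    simp only [mem_ofPred_eq] at hz ⊢
    have h1 := hhigh z
    rw [← ofReal_norm, ENNReal.ofReal_le_ofReal_iff (by positivity)] at h1
    rw [hsum, Pi.add_apply] at hz
    have h2 := norm_add_le (ft (E.indicator f) z) (ft (Eᶜ.indicator f) z)
    rw [← ofReal_norm, ← ENNReal.ofReal_pow (norm_nonneg _)]
    apply ENNReal.ofReal_le_ofReal
    nlinarith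
  have hcheb := mul_meas_ge_le_lintegral (μ := volume) (f := fun z => ‖ft (E.indicator f) z‖ₑ ^ 2)
    ((continuous_ft hi1).measurable.enorm.pow_const 2) (ENNReal.ofReal (α ^ 2 / 4))
  rw [lintegral_enorm_ft_sq hi1 hmem2] at hcheb
  have hind : ∀ x, ‖E.indicator f x‖ₑ ^ 2 =
      E.indicator (fun x => ENNReal.ofReal (‖f x‖ ^ 2)) x := by
    intro x
    by_cases hx : x ∈ E
    · simp only [indicator_of_mem hx]
      rw [← ofReal_norm, ENNReal.ofReal_pow (norm_nonneg _)]
    · simp [hx]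
  simp_rw [hind] at hcheb
  refine (measure_mono hsub).trans ?_
  set I := ∫⁻ x, E.indicator (fun x => ENNReal.ofReal (‖f x‖ ^ 2)) x with hI
  have hc : ENNReal.ofReal (8 * Real.pi * α ^ (-2 : ℝ)) =
      ENNReal.ofReal (2 * Real.pi) / ENNReal.ofReal (α ^ 2 / 4) := by
    rw [← ENNReal.ofReal_div_of_pos (by positivity)]
    congr 1
    rw [Real.rpow_neg hα.le, Real.rpow_two]
    field_simp; ring
  rw [hc, ENNReal.div_eq_inv_mul, mul_assoc, ← ENNReal.div_eq_inv_mul]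
  rw [ENNReal.le_div_iff_mul_le (Or.inl (by simp; positivity)) (Or.inl (by simp)), mul_comm]
  exact hcheb

/-- Layer-cake formula, the distribution estimate, then Tonelli. For fixed `x` the variable `α` runs
up to `2A‖f x‖^(1-p)`, and the integral of `α^(q-3)` converges at 0 because `q > 2`. Conjugacy gives
`2 + (1-p)(q-2) = p`, so one factor `A` comes from the remaining integral in `x` and `A^(q-2)` from
the cutoff. -/
theorem lintegral_norm_ft_rpow_le {f : ℝ → ℂ} (hfm : Measurable f) (hf : Integrable f) {p q A : ℝ}
    (hp : 1 < p) (hq : 2 < q) (hpq : (p - 1) * (q - 1) = 1) (hA : 0 < A)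
    (hfA : ∫⁻ x, ENNReal.ofReal (‖f x‖ ^ p) = ENNReal.ofReal A) :
    ∫⁻ z, ENNReal.ofReal (‖ft f z‖ ^ q) ≤
      ENNReal.ofReal (q * (8 * Real.pi) * (2 ^ (q - 2) / (q - 2))) *
        ENNReal.ofReal (A ^ (q - 1)) := by
  have hp1 : 0 < p - 1 := by linarith
  rw [lintegral_rpow_eq_lintegral_meas_lt_mul volume (Eventually.of_forall fun z => norm_nonneg _)
    (continuous_ft hf).norm.measurable.aemeasurable (by linarith)]
  set G : ℝ → ℝ → ℝ≥0∞ := fun α x => ENNReal.ofReal (α ^ (q - 2 - 1)) *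
    {y : ℝ × ℝ | y.1 * ‖f y.2‖ ^ (p - 1) ≤ 2 * A}.indicator
      (fun y => ENNReal.ofReal (‖f y.2‖ ^ 2)) (α, x) with hG
  have hGm : Measurable (Function.uncurry G) := by
    apply Measurable.mul
    · fun_prop
    · exact Measurable.indicator (by fun_prop) (measurableSet_le (by fun_prop) (by fun_prop))
  have h1 : ∫⁻ α in Ioi 0, volume {z | α < ‖ft f z‖} * ENNReal.ofReal (α ^ (q - 1)) ≤
      ∫⁻ α in Ioi 0, ENNReal.ofReal (8 * Real.pi) * ∫⁻ x, G α x := by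
    apply setLIntegral_mono' measurableSet_Ioi
    intro α hα
    have hα : 0 < α := hα
    have := volume_lt_norm_ft_le hfm hf hp hA hfA.le hα
    calc volume {z | α < ‖ft f z‖} * ENNReal.ofReal (α ^ (q - 1)) ≤ _ := mul_le_mul_left this _
      _ = _ := by
        rw [hG]; dsimp only
        rw [lintegral_const_mul, mul_right_comm, ← ENNReal.ofReal_mul (by positivity), ← mul_assoc,
          ← ENNReal.ofReal_mul (by positivity)]
        · congr 2
          rw [mul_assoc, ← Real.rpow_add hα]
          congr 2; ring
        · exact Measurable.indicator (f := fun x => ENNReal.ofReal (‖f x‖ ^ 2))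
            (s := {x | α * ‖f x‖ ^ (p - 1) ≤ 2 * A}) (by fun_prop)
            (measurableSet_le (by fun_prop) (by fun_prop))
  have h2 : ∀ x, ∫⁻ α in Ioi 0, G α x ≤
      ENNReal.ofReal (2 ^ (q - 2) / (q - 2) * A ^ (q - 2)) * ENNReal.ofReal (‖f x‖ ^ p) := by
    intro x
    rcases (norm_nonneg (f x)).eq_or_lt with h0 | h0
    · have : ∀ α, G α x = 0 := by
        intro α
        simp only [hG, indicator, ← h0]; simp
      simp [this]
    · set b := 2 * A * ‖f x‖ ^ (1 - p) with hb
      have hb0 : 0 < b := by positivity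
      have hGx : ∀ α, G α x = ENNReal.ofReal (‖f x‖ ^ 2) *
          (Iic b).indicator (fun α => ENNReal.ofReal (α ^ (q - 2 - 1))) α := by
        intro α
        have hiff : α * ‖f x‖ ^ (p - 1) ≤ 2 * A ↔ α ≤ b := by
          rw [hb, show (1 - p) = -(p - 1) by ring, Real.rpow_neg h0.le, ← div_eq_mul_inv,
            le_div_iff₀ (by positivity)]
        simp only [hG, indicator, mem_ofPred_eq, mem_Iic, hiff]
        split_ifs <;> simp [mul_comm]
      simp_rw [hGx]
      rw [lintegral_const_mul _ (Measurable.indicator (by fun_prop) measurableSet_Iic),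
        lintegral_Ioi_indicator_rpow hb0 (by linarith), ← ENNReal.ofReal_mul (by positivity),
        ← ENNReal.ofReal_mul (by have : 0 < q - 2 := by linarith
                                 positivity)]
      apply ENNReal.ofReal_le_ofReal
      rw [hb, Real.mul_rpow (by positivity) (by positivity), Real.mul_rpow (by positivity) hA.le,
        ← Real.rpow_mul h0.le]
      have : ‖f x‖ ^ p = ‖f x‖ ^ 2 * ‖f x‖ ^ ((1 - p) * (q - 2)) := by
        rw [← Real.rpow_two, ← Real.rpow_add h0]
        congr 1; linarith
      rw [this]
      apply le_of_eq; ring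
  calc _ ≤ ENNReal.ofReal q * ∫⁻ α in Ioi 0, ENNReal.ofReal (8 * Real.pi) * ∫⁻ x, G α x := by gcongr
    _ = ENNReal.ofReal q * (ENNReal.ofReal (8 * Real.pi) * ∫⁻ x, ∫⁻ α in Ioi 0, G α x) := by
      rw [lintegral_const_mul _ (f := fun α => ∫⁻ x, G α x) hGm.lintegral_prod_right', lintegral_lintegral_swap hGm.aemeasurable]
    _ ≤ ENNReal.ofReal q * (ENNReal.ofReal (8 * Real.pi) * ∫⁻ x,
      ENNReal.ofReal (2 ^ (q - 2) / (q - 2) * A ^ (q - 2)) * ENNReal.ofReal (‖f x‖ ^ p)) := by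
      gcongr with x; exact h2 x
    _ = _ := by
      have : 0 < q - 2 := by linarith
      rw [lintegral_const_mul _ (by fun_prop), hfA, ← ENNReal.ofReal_mul (by positivity),
        ← ENNReal.ofReal_mul (by positivity), ← ENNReal.ofReal_mul (by positivity),
        ← ENNReal.ofReal_mul (by positivity)]
      congr 1
      rw [show q - 1 = (q - 2) + 1 by ring, Real.rpow_add_one hA.ne']
      ring

/-- The Hausdorff–Young inequality, with some constant. -/
theorem exists_eLpNorm_ft_le {p q : ℝ≥0∞} (hp1 : 1 ≤ p) (hp : p ≤ 2) (hpq : p⁻¹ + q⁻¹ = 1) :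
    ∃ C : ℝ≥0∞, C ≠ ∞ ∧ ∀ f : ℝ → ℂ, Integrable f → eLpNorm (ft f) q ≤ C * eLpNorm f p := by
  have hptop : p ≠ ∞ := ne_top_of_le_ne_top (by norm_num) hp
  have hp0 : p ≠ 0 := (zero_lt_one.trans_le hp1).ne'
  rcases hp1.eq_or_lt with rfl | hp1
  · have : q = ∞ := by
      rw [inv_one] at hpq
      have : q⁻¹ = 0 := by
        have h : (1 : ℝ≥0∞) + q⁻¹ = 1 + 0 := by simpa using hpq
        exact (ENNReal.add_right_inj (by simp)).1 h
      simpa using this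
    subst this
    refine ⟨1, by simp, fun f hf => ?_⟩
    rw [one_mul]
    exact eLpNormEssSup_le_of_ae_enorm_bound (Eventually.of_forall (enorm_ft_le f))
  rcases hp.eq_or_lt with rfl | hp2
  · have : q = 2 := by
      have h : (2 : ℝ≥0∞)⁻¹ + q⁻¹ = 2⁻¹ + 2⁻¹ := by rw [hpq, ENNReal.inv_two_add_inv_two]
      exact inv_injective ((ENNReal.add_right_inj (by simp)).1 h)
    subst this
    refine ⟨ENNReal.ofReal (2 * Real.pi) ^ (1 / 2 : ℝ), ENNReal.rpow_ne_top_of_nonneg (by norm_num) (by finiteness), fun f hf => ?_⟩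
    by_cases h2 : eLpNorm f 2 = ∞
    · rw [h2, ENNReal.mul_top]
      · exact le_top
      · simp [Real.pi_pos]
    · have := lintegral_enorm_ft_sq hf ⟨hf.1, Ne.lt_top h2⟩
      rw [eLpNorm_eq_lintegral_rpow_enorm_toReal (by norm_num) (by norm_num),
        eLpNorm_eq_lintegral_rpow_enorm_toReal (by norm_num) (by norm_num),
        ENNReal.toReal_ofNat, ← ENNReal.mul_rpow_of_nonneg _ _ (by norm_num)]
      simp [this]
  · have hconj : p.HolderConjugate q := ENNReal.holderConjugate_iff.2 hpq
    lift p to NNReal using hptop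
    have hqtop : q ≠ ∞ := by
      rintro rfl
      simp only [ENNReal.inv_top, add_zero, ENNReal.inv_eq_one] at hpq
      exact hp1.ne' hpq
    have hq0 : q ≠ 0 := by
      rintro rfl
      simp at hpq
    lift q to NNReal using hqtop
    have hp1' : (1 : ℝ) < p := by exact_mod_cast hp1
    have hp2' : (p : ℝ) < 2 := by exact_mod_cast hp2
    have hq0' : (0 : ℝ) < q := by
      have : q ≠ 0 := by exact_mod_cast hq0
      positivity
    have hpq' : (p : ℝ)⁻¹ + (q : ℝ)⁻¹ = 1 := by
      have := congrArg ENNReal.toReal hpq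
      rw [ENNReal.toReal_add (by simpa using hp0) (by simpa using hq0)] at this
      simpa using this
    have hpq2 : ((p : ℝ) - 1) * (q - 1) = 1 := by
      field_simp at hpq'
      linarith
    have hq2 : (2 : ℝ) < q := by nlinarith
    -- Since `q - 1 = q / p`, the `q`-th root of `A^(q-1)` is `A^(1/p)`, the `L^p` norm.
    have hsub : (q : ℝ) * (p : ℝ)⁻¹ = q - 1 := by
      field_simp; linarith
    set C := ENNReal.ofReal ((q : ℝ) * (8 * Real.pi) * (2 ^ ((q : ℝ) - 2) / (q - 2))) with hC
    refine ⟨C ^ (1 / (q : ℝ)), by simp [hC], fun f hf => ?_⟩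
    -- pass to a measurable representative
    set g := hf.1.mk f with hg
    have hfg : f =ᵐ[volume] g := hf.1.ae_eq_mk
    rw [ft_congr hfg, eLpNorm_congr_ae hfg]
    have hgm : Measurable g := hf.1.stronglyMeasurable_mk.measurable
    have hgi : Integrable g := hf.congr hfg
    rw [eLpNorm_eq_lintegral_rpow_enorm_toReal hq0 (by simp),
      eLpNorm_eq_lintegral_rpow_enorm_toReal hp0 (by simp)]
    simp only [ENNReal.coe_toReal]
    have hr : ∀ {r : ℝ} (hr : 0 < r) (w : ℂ), ‖w‖ₑ ^ r = ENNReal.ofReal (‖w‖ ^ r) := by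
      intro r hr w
      rw [← ofReal_norm, ENNReal.ofReal_rpow_of_nonneg (norm_nonneg _) hr.le]
    simp_rw [hr hq0', hr (show (0 : ℝ) < p by linarith)]
    set A' := ∫⁻ x, ENNReal.ofReal (‖g x‖ ^ (p : ℝ)) with hA'
    -- The interpolation bound needs `0 < A < ∞`. The infinite case is trivial only because the
    -- constant is nonzero.
    by_cases htop : A' = ∞
    · rw [htop, ENNReal.top_rpow_of_pos (by positivity), ENNReal.mul_top]
      · exact le_top
      · have : 0 < (q : ℝ) - 2 := by linarith
        rw [hC, ENNReal.ofReal_rpow_of_pos (by positivity)]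
        simp; positivity
    by_cases hzero : A' = 0
    · have hg0 : g =ᵐ[volume] 0 := by
        rw [hA', lintegral_eq_zero_iff (by fun_prop)] at hzero
        filter_upwards [hzero] with x hx
        have hx : ‖g x‖ ^ (p : ℝ) ≤ 0 := by simpa using hx
        by_contra hne
        have : 0 < ‖g x‖ := norm_pos_iff.2 hne
        have := Real.rpow_pos_of_pos this (p : ℝ)
        linarith
      have : ∀ z, ft g z = 0 := by
        intro z
        rw [ft_congr hg0]; simp [ft]
      have : ∫⁻ z, ENNReal.ofReal (‖ft g z‖ ^ (q : ℝ)) = 0 := by simp [this, hq0'.ne']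
      rw [this, ENNReal.zero_rpow_of_pos (by positivity)]
      exact zero_le
    have hApos : 0 < A'.toReal := ENNReal.toReal_pos hzero htop
    have := lintegral_norm_ft_rpow_le hgm hgi hp1' hq2 hpq2 hApos (ENNReal.ofReal_toReal htop).symm
    calc _ ≤ (C * ENNReal.ofReal (A'.toReal ^ ((q : ℝ) - 1))) ^ (1 / (q : ℝ)) := by gcongr
      _ = _ := by
        rw [ENNReal.mul_rpow_of_nonneg _ _ (by positivity), ← ENNReal.ofReal_rpow_of_pos hApos,
          ENNReal.ofReal_toReal htop, ← ENNReal.rpow_mul, ← hsub]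
        congr 2
        field_simp

/-! ### Transforms as limits over truncations -/

/-- Truncation of a function to `(-N, N]`. -/
noncomputable def trunc (N : ℝ) (f : ℝ → ℂ) : ℝ → ℂ := (Ioc (-N) N).indicator f

theorem ft_trunc {N : ℝ} (hN : 0 ≤ N) (f : ℝ → ℂ) (z : ℝ) :
    ft (trunc N f) z = ∫ x in (-N)..N, f x * Complex.exp (-(Complex.I * ((x * z : ℝ) : ℂ))) := by
  rw [intervalIntegral.integral_of_le (by linarith), ← integral_indicator measurableSet_Ioc, ft]
  congr 1; ext x
  by_cases hx : x ∈ Ioc (-N) N <;> simp [trunc, hx]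

theorem memLp_trunc {p : ℝ≥0∞} {f : ℝ → ℂ} (hf : MemLp f p) (N : ℝ) : MemLp (trunc N f) p :=
  hf.indicator measurableSet_Ioc

theorem integrable_trunc {p : ℝ≥0∞} (hp : 1 ≤ p) {f : ℝ → ℂ} (hf : MemLp f p) (N : ℝ) :
    Integrable (trunc N f) := by
  rw [trunc, integrable_indicator_iff measurableSet_Ioc]
  exact (hf.restrict _).integrable hp

theorem tendsto_eLpNorm_sub_trunc {p : ℝ≥0∞} (hp0 : p ≠ 0) (hp : p ≠ ∞) {f : ℝ → ℂ}
    (hf : MemLp f p) : Tendsto (fun N => eLpNorm (f - trunc N f) p) atTop (𝓝 0) := by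
  have hpr : 0 < p.toReal := ENNReal.toReal_pos hp0 hp
  simp_rw [eLpNorm_eq_lintegral_rpow_enorm_toReal hp0 hp]
  have h0 : (0 : ℝ≥0∞) = (∫⁻ _ : ℝ, 0) ^ (1 / p.toReal) := by
    simp [hpr]
  rw [h0]
  refine (ENNReal.continuous_rpow_const.tendsto _).comp ?_
  refine tendsto_lintegral_filter_of_dominated_convergence' (fun x => ‖f x‖ₑ ^ p.toReal) ?_ ?_ ?_ ?_
  · filter_upwards with N
    exact ((hf.1.sub (memLp_trunc hf N).1).enorm.pow_const _)
  · filter_upwards with N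
    filter_upwards with x
    gcongr
    by_cases hx : x ∈ Ioc (-N) N <;> simp [trunc, hx]
  · exact (lintegral_rpow_enorm_lt_top_of_eLpNorm_lt_top hp0 hp hf.2).ne
  · filter_upwards with x
    apply tendsto_const_nhds.congr'
    filter_upwards [eventually_gt_atTop |x|] with N hN
    have hx : x ∈ Ioc (-N) N := ⟨by linarith [neg_abs_le x], by linarith [le_abs_self x]⟩
    simp [trunc, hx, hpr]

/-- `F` is the `L^q` limit of the Fourier transforms of the truncations of `f`. -/
def HasFT (q : ℝ≥0∞) (f F : ℝ → ℂ) : Prop :=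
  Tendsto (fun N : ℝ => eLpNorm (F - ft (trunc N f)) q) atTop (𝓝 0)

theorem isTransform_iff_hasFT {q : ℝ≥0∞} (f : ℝ → ℂ) (F : Lp ℂ q (volume : Measure ℝ)) :
    IsTransform (fun u => Complex.exp (-(Complex.I * u))) q volume f F ↔ HasFT q f F := by
  apply tendsto_congr'
  filter_upwards [eventually_ge_atTop 0] with N hN
  congr 1; ext z
  rw [Pi.sub_apply, ft_trunc hN]

theorem tendsto_const_mul_zero {α : Type*} {l : Filter α} {u : α → ℝ≥0∞} {c : ℝ≥0∞} (hc : c ≠ ∞)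
    (hu : Tendsto u l (𝓝 0)) : Tendsto (fun a => c * u a) l (𝓝 0) := by
  have h := ENNReal.Tendsto.const_mul (a := c) hu (Or.inr hc)
  rwa [mul_zero] at h

/-- Data of the Hausdorff–Young inequality for the pair of exponents `p`, `q`. -/
structure HausdorffYoung (p q C : ℝ≥0∞) : Prop where
  one_le : 1 ≤ p
  le_two : p ≤ 2
  conj : p.HolderConjugate q
  const_ne_top : C ≠ ∞
  bound : ∀ f : ℝ → ℂ, Integrable f → eLpNorm (ft f) q ≤ C * eLpNorm f p

namespace HausdorffYoung

variable {p q C : ℝ≥0∞} (H : HausdorffYoung p q C)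
include H

theorem ne_top : p ≠ ∞ := ne_top_of_le_ne_top (by norm_num) H.le_two

theorem ne_zero : p ≠ 0 := (zero_lt_one.trans_le H.one_le).ne'

theorem two_le : 2 ≤ q := by
  have h := ENNReal.holderConjugate_iff.1 H.conj
  rw [← ENNReal.inv_le_inv]
  have h1 : (2 : ℝ≥0∞)⁻¹ ≤ p⁻¹ := ENNReal.inv_le_inv.2 H.le_two
  have h2 : (2 : ℝ≥0∞)⁻¹ + q⁻¹ ≤ 2⁻¹ + 2⁻¹ := by
    rw [ENNReal.inv_two_add_inv_two, ← h]; gcongr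
  exact (ENNReal.add_le_add_iff_left (by simp)).1 h2

theorem one_le_conj : 1 ≤ q := le_trans (by norm_num) H.two_le

/-- The truncations converge in `L^p`, so by Hausdorff–Young their transforms are Cauchy in `L^q`,
which is complete. -/
theorem exists_hasFT {f : ℝ → ℂ} (hf : MemLp f p) : ∃ F : Lp ℂ q (volume : Measure ℝ), HasFT q f F := by
  have hmem : ∀ N, MemLp (ft (trunc N f)) q := fun N =>
    ⟨(continuous_ft (integrable_trunc H.one_le hf N)).aestronglyMeasurable,
      (H.bound _ (integrable_trunc H.one_le hf N)).trans_lt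
        (ENNReal.mul_lt_top (Ne.lt_top H.const_ne_top) (memLp_trunc hf N).2)⟩
  have : Fact (1 ≤ q) := ⟨H.one_le_conj⟩
  set G : ℝ → Lp ℂ q (volume : Measure ℝ) := fun N => (hmem N).toLp _ with hG
  have hdist : ∀ N M, edist (G N) (G M) ≤
      C * (eLpNorm (f - trunc N f) p + eLpNorm (f - trunc M f) p) := by
    intro N M
    rw [hG, Lp.edist_toLp_toLp, ← ft_sub (integrable_trunc H.one_le hf N)
      (integrable_trunc H.one_le hf M)]
    refine (H.bound _ ((integrable_trunc H.one_le hf N).sub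
      (integrable_trunc H.one_le hf M))).trans ?_
    gcongr
    have : trunc N f - trunc M f = (f - trunc M f) - (f - trunc N f) := by ring
    rw [this, add_comm]
    exact eLpNorm_sub_le (hf.1.sub (memLp_trunc hf M).1) (hf.1.sub (memLp_trunc hf N).1) H.one_le
  have hlim := tendsto_eLpNorm_sub_trunc H.ne_zero H.ne_top hf
  have hcauchy : Cauchy (map G atTop) := by
    refine EMetric.cauchy_iff.2 ⟨(inferInstance : NeBot (map G atTop)).ne, fun ε hε => ?_⟩
    have h3 := tendsto_const_mul_zero H.const_ne_top hlim
    have h4 := h3.eventually (gt_mem_nhds (ENNReal.half_pos hε.ne'))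
    refine ⟨G '' {N | C * eLpNorm (f - trunc N f) p < ε / 2}, image_mem_map ?_, ?_⟩
    · exact h4
    rintro _ ⟨N, hN, rfl⟩ _ ⟨M, hM, rfl⟩
    refine (hdist N M).trans_lt ?_
    rw [mul_add, ← ENNReal.add_halves ε]
    have hN' : C * eLpNorm (f - trunc N f) p < ε / 2 := hN
    have hM' : C * eLpNorm (f - trunc M f) p < ε / 2 := hM
    exact ENNReal.add_lt_add hN' hM'
  obtain ⟨F, hF⟩ := CompleteSpace.complete hcauchy
  refine ⟨F, ?_⟩
  have : Tendsto (fun N => edist (G N) F) atTop (𝓝 0) := tendsto_iff_edist_tendsto_0.1 hF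
  refine this.congr fun N => ?_
  rw [edist_comm, Lp.edist_def]
  apply eLpNorm_congr_ae
  filter_upwards [(hmem N).coeFn_toLp] with x hx
  simp [hG, hx]

/-- Hausdorff–Young for `f - g`, where `f` need not be integrable: insert a truncation of `f` and
let it grow. The choice `g = 0` gives the bound for `F` itself. -/
theorem eLpNorm_sub_ft_le {f F g : ℝ → ℂ} (hf : MemLp f p) (hF : AEStronglyMeasurable F)
    (hfF : HasFT q f F) (hg : Integrable g) :
    eLpNorm (F - ft g) q ≤ C * eLpNorm (f - g) p := by
  have hlim := tendsto_eLpNorm_sub_trunc H.ne_zero H.ne_top hf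
  have h3 : Tendsto (fun N => eLpNorm (F - ft (trunc N f)) q +
      C * (eLpNorm (f - g) p + eLpNorm (f - trunc N f) p)) atTop
      (𝓝 (0 + C * (eLpNorm (f - g) p + 0))) :=
    hfF.add (ENNReal.Tendsto.const_mul (tendsto_const_nhds.add hlim) (Or.inr H.const_ne_top))
  rw [zero_add, add_zero] at h3
  refine ge_of_tendsto' h3 fun N => ?_
  have hN := integrable_trunc H.one_le hf N
  have e1 : F - ft g = (F - ft (trunc N f)) + ft (trunc N f - g) := by
    rw [ft_sub hN hg]; ring
  rw [e1]
  refine (eLpNorm_add_le (hF.sub (continuous_ft hN).aestronglyMeasurable)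
    (continuous_ft (hN.sub hg)).aestronglyMeasurable H.one_le_conj).trans ?_
  gcongr
  refine (H.bound _ (hN.sub hg)).trans ?_
  gcongr
  have e2 : trunc N f - g = (f - g) - (f - trunc N f) := by ring
  rw [e2]
  exact eLpNorm_sub_le (hf.1.sub hg.1) (hf.1.sub hN.1) H.one_le

end HausdorffYoung

/-! ### Hölder's inequality, translation kernels and their multipliers -/

theorem eLpNorm_one_mul_le {p q : ℝ≥0∞} [p.HolderConjugate q] {f g : ℝ → ℂ}
    (hf : AEStronglyMeasurable f) (hg : AEStronglyMeasurable g) :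
    eLpNorm (fun x => f x * g x) 1 ≤ eLpNorm f p * eLpNorm g q := by
  have h := eLpNorm_le_eLpNorm_mul_eLpNorm_of_nnnorm (p := p) (q := q) (r := 1) hf hg
    (fun a b : ℂ => a * b) 1 (Eventually.of_forall fun x => by simp)
  simpa using h

theorem enorm_integral_mul_le {p q : ℝ≥0∞} [p.HolderConjugate q] {f g : ℝ → ℂ}
    (hf : AEStronglyMeasurable f) (hg : AEStronglyMeasurable g) :
    ‖∫ x, f x * g x‖ₑ ≤ eLpNorm f p * eLpNorm g q := by
  refine (enorm_integral_le_lintegral_enorm _).trans ?_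
  rw [← eLpNorm_one_eq_lintegral_enorm]
  exact eLpNorm_one_mul_le hf hg

/-- A family of even probability densities `k t`, `t > 0`, with Fourier transforms `m t`. -/
structure IsTranslationKernel (k m : ℝ → ℝ → ℝ) : Prop where
  measurable : Measurable (Function.uncurry k)
  nonneg : ∀ t, 0 < t → ∀ u, 0 ≤ k t u
  bdd : ∀ t, 0 < t → ∃ B, ∀ u, k t u ≤ B
  integrable : ∀ t, 0 < t → Integrable (k t)
  integral_eq_one : ∀ t, 0 < t → ∫ u, k t u = 1
  ft_eq : ∀ t, 0 < t → ∀ x, ft (fun u => (k t u : ℂ)) x = m t x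
  mult_neg : ∀ t x, m t (-x) = m t x
  mult_nonneg : ∀ t x, 0 ≤ m t x
  mult_le_one : ∀ t, 0 ≤ t → ∀ x, m t x ≤ 1
  mult_zero : ∀ x, m 0 x = 1
  mult_continuous : ∀ t, Continuous (m t)
  mult_lipschitz : ∀ R, ∃ L, 0 ≤ L ∧ ∀ s t, 0 ≤ s → 0 ≤ t → ∀ x, |x| ≤ R →
    |m s x - m t x| ≤ L * |s - t|
  mult_decay : ∀ t, 0 < t → ∃ R, 0 < R ∧ ∀ x, R < |x| → m t x ≤ 1 / 2
  mult_sq : ∃ A, 0 ≤ A ∧ ∀ t, 0 < t →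
    eLpNorm (m t) 2 ≤ ENNReal.ofReal (A * (1 + t ^ (-(1 / 2) : ℝ)))

/-- The translation with kernel `k`, the identity for `t = 0`. -/
noncomputable def kernelTranslation (k : ℝ → ℝ → ℝ) (t : ℝ) (f : ℝ → ℂ) (x : ℝ) : ℂ :=
  if t = 0 then f x else ∫ ξ, (k t (x - ξ) : ℂ) * f ξ

/-- For functions bounded by one, the `L^r` norm is controlled by the `L^s` norm, `s ≤ r`. -/
theorem eLpNorm_le_one_add {f : ℝ → ℝ} (hf : ∀ x, ‖f x‖ ≤ 1) {s r : ℝ≥0∞} (hs : s ≠ 0)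
    (hs' : s ≠ ∞) (hsr : s ≤ r) : eLpNorm f r ≤ 1 + eLpNorm f s := by
  have he : ∀ x, ‖f x‖ₑ ≤ 1 := fun x => by
    rw [← ofReal_norm]; exact ENNReal.ofReal_le_one.2 (hf x)
  by_cases hr : r = ∞
  · subst hr
    exact le_add_right (eLpNormEssSup_le_of_ae_enorm_bound (Eventually.of_forall he))
  have hs0 : 0 < s.toReal := ENNReal.toReal_pos hs hs'
  have hsr' : s.toReal ≤ r.toReal := (ENNReal.toReal_le_toReal hs' hr).2 hsr
  rw [eLpNorm_eq_lintegral_rpow_enorm_toReal hs hs',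
    eLpNorm_eq_lintegral_rpow_enorm_toReal (fun h => hs (by simpa [h] using hsr)) hr]
  have h1 : ∫⁻ x, ‖f x‖ₑ ^ r.toReal ≤ ∫⁻ x, ‖f x‖ₑ ^ s.toReal :=
    lintegral_mono fun x => ENNReal.rpow_le_rpow_of_exponent_ge (he x) hsr'
  refine (ENNReal.rpow_le_rpow h1 (by positivity)).trans ?_
  rcases le_total (∫⁻ x, ‖f x‖ₑ ^ s.toReal) 1 with h | h
  · exact le_add_right (ENNReal.rpow_le_one h (by positivity))
  · refine le_add_left (ENNReal.rpow_le_rpow_of_exponent_le h ?_)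
    gcongr

theorem memLp_of_integrable_of_bdd {f : ℝ → ℝ} (hf : Integrable f) {B : ℝ} (hB : ∀ x, ‖f x‖ ≤ B)
    {r : ℝ≥0∞} (hr : 1 ≤ r) : MemLp f r := by
  have hB0 : 0 < |B| + 1 := by positivity
  -- Rescaling brings the function below one; `|B| + 1` is positive even if `B` is not.
  have h1 : MemLp (fun x => (|B| + 1)⁻¹ * f x) r := by
    refine ⟨(hf.1.const_mul _), ?_⟩
    refine (eLpNorm_le_one_add (s := 1) ?_ one_ne_zero ENNReal.one_ne_top hr).trans_lt ?_
    · intro x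
      rw [norm_mul, norm_inv, Real.norm_of_nonneg hB0.le, inv_mul_le_iff₀ hB0]
      linarith [hB x, le_abs_self B]
    · exact ENNReal.add_lt_top.2 ⟨by simp, (memLp_one_iff_integrable.2 (hf.const_mul _)).2⟩
  have h2 := h1.const_mul (|B| + 1)
  refine h2.congr_norm hf.1 (Eventually.of_forall fun x => ?_)
  rw [mul_inv_cancel_left₀ hB0.ne']

namespace IsTranslationKernel

variable {k m : ℝ → ℝ → ℝ} (h : IsTranslationKernel k m)
include h

theorem memLp {t : ℝ} (ht : 0 < t) {r : ℝ≥0∞} (hr : 1 ≤ r) :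
    MemLp (fun u => (k t u : ℂ)) r := by
  obtain ⟨B, hB⟩ := h.bdd t ht
  exact (memLp_of_integrable_of_bdd (h.integrable t ht)
    (fun u => by rw [Real.norm_of_nonneg (h.nonneg t ht u)]; exact hB u) hr).ofReal

theorem memLp_sub {t : ℝ} (ht : 0 < t) {r : ℝ≥0∞} (hr : 1 ≤ r) (z : ℝ) :
    MemLp (fun ξ => (k t (z - ξ) : ℂ)) r :=
  (h.memLp ht hr).comp_measurePreserving (Measure.measurePreserving_sub_left volume z)

/-- As `0 ≤ m t ≤ 1`, the `L²` bound controls every `L^q` norm with `q ≥ 2`, including `q = ∞`. -/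
theorem exists_eLpNorm_mult_le {q : ℝ≥0∞} (hq : 2 ≤ q) : ∃ A, 0 ≤ A ∧ ∀ t, 0 < t →
    eLpNorm (fun x => (m t x : ℂ)) q ≤ ENNReal.ofReal (A * (1 + t ^ (-(1 / 2) : ℝ))) := by
  obtain ⟨A, hA, hAt⟩ := h.mult_sq
  refine ⟨1 + A, by positivity, fun t ht => ?_⟩
  have e : eLpNorm (fun x => (m t x : ℂ)) q = eLpNorm (m t) q :=
    eLpNorm_congr_norm_ae (Eventually.of_forall fun x => by simp)
  rw [e]
  refine (eLpNorm_le_one_add (s := 2) (fun x => ?_) (by norm_num) (by norm_num) hq).trans ?_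
  · rw [Real.norm_of_nonneg (h.mult_nonneg t x)]
    exact h.mult_le_one t ht.le x
  · refine (add_le_add_right (hAt t ht) 1).trans ?_
    rw [← ENNReal.ofReal_one, ← ENNReal.ofReal_add (by norm_num) (by positivity)]
    apply ENNReal.ofReal_le_ofReal
    have : 0 ≤ t ^ (-(1 / 2) : ℝ) := by positivity
    nlinarith

theorem memLp_mult {q : ℝ≥0∞} (hq : 2 ≤ q) {t : ℝ} (ht : 0 < t) :
    MemLp (fun x => (m t x : ℂ)) q := by
  obtain ⟨A, -, hA⟩ := h.exists_eLpNorm_mult_le hq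
  exact ⟨(Complex.continuous_ofReal.comp (h.mult_continuous t)).aestronglyMeasurable,
    (hA t ht).trans_lt ENNReal.ofReal_lt_top⟩

/-- Reflecting the kernel replaces `m t x` by `m t (-x)`, which is the same by evenness; the shift
by `z` gives the exponential. -/
theorem ft_kernel_sub {t : ℝ} (ht : 0 < t) (z x : ℝ) :
    ft (fun ξ => (k t (z - ξ) : ℂ)) x = Complex.exp (-(Complex.I * ((x * z : ℝ) : ℂ))) * m t x := by
  rw [ft, ← integral_sub_left_eq_self (fun ξ => (k t (z - ξ) : ℂ) * _) volume z]
  rw [← h.mult_neg, ← h.ft_eq t ht, ft, ← integral_const_mul]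
  congr 1; ext u
  rw [sub_sub_cancel, mul_left_comm, ← Complex.exp_add]
  congr 2
  push_cast; ring

/-- The multiplication formula: the transform is moved from `f` to the reflected, shifted kernel,
whose transform is explicit. -/
theorem integral_kernel_mul_ft {t : ℝ} (ht : 0 < t) {f : ℝ → ℂ} (hf : Integrable f) (z : ℝ) :
    ∫ ξ, (k t (z - ξ) : ℂ) * ft f ξ = ft (fun x => m t x * f x) z := by
  have hk : Integrable fun ξ => (k t (z - ξ) : ℂ) := memLp_one_iff_integrable.1 (h.memLp_sub ht le_rfl z)
  have h1 := VectorFourier.integral_fourierIntegral_smul_eq_flip (L := LinearMap.mul ℝ ℝ)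
    (e := Real.probChar) (by fun_prop) (by simp; fun_prop) hf hk
  have hflip : (LinearMap.mul ℝ ℝ).flip = LinearMap.mul ℝ ℝ := by
    ext; simp
  rw [hflip, ← ft_eq_vectorFourier, ← ft_eq_vectorFourier] at h1
  simp only [smul_eq_mul] at h1
  simp_rw [mul_comm (Complex.ofReal _) (ft f _)]
  rw [h1, ft]
  congr 1; ext x
  rw [h.ft_kernel_sub ht]
  ring

/-- The translate of the transform of `f` is the transform of `m t * f`, at every point. -/
theorem kernelTranslation_eq_ft {p q C : ℝ≥0∞} (H : HausdorffYoung p q C) {f F : ℝ → ℂ}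
    (hf : MemLp f p) (hF : AEStronglyMeasurable F) (hfF : HasFT q f F) {t : ℝ} (ht : 0 < t)
    (z : ℝ) : Integrable (fun x => m t x * f x) ∧
      kernelTranslation k t F z = ft (fun x => m t x * f x) z := by
  have := H.conj
  have hmt := h.memLp_mult H.two_le ht
  have hint : ∀ {g : ℝ → ℂ}, MemLp g p → Integrable (fun x => m t x * g x) := fun {g} hg => by
    have := hmt.integrable_mul hg
    exact this
  refine ⟨hint hf, ?_⟩
  rw [kernelTranslation, if_neg ht.ne']
  have hlim := tendsto_eLpNorm_sub_trunc H.ne_zero H.ne_top hf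
  have hkz := h.memLp_sub ht H.one_le z
  have hftm : ∀ N, MemLp (ft (trunc N f)) q := fun N =>
    ⟨(continuous_ft (integrable_trunc H.one_le hf N)).aestronglyMeasurable,
      (H.bound _ (integrable_trunc H.one_le hf N)).trans_lt
        (ENNReal.mul_lt_top (Ne.lt_top H.const_ne_top) (memLp_trunc hf N).2)⟩
  have hFm : MemLp F q := by
    refine ⟨hF, ?_⟩
    have := H.eLpNorm_sub_ft_le hf hF hfF (g := 0) (integrable_zero _ _ _)
    have h0 : ft 0 = 0 := by ext z; simp [ft]
    rw [h0, sub_zero, sub_zero] at this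
    exact this.trans_lt (ENNReal.mul_lt_top (Ne.lt_top H.const_ne_top) hf.2)
  -- The identity is known for truncations. Both sides converge as `N → ∞` by Hölder: here the
  -- kernel lies in `L^p` and the transforms converge in `L^q`; in `hright` the truncations converge
  -- in `L^p` and `m t` lies in `L^q`.
  have hleft : Tendsto (fun N => ∫ ξ, (k t (z - ξ) : ℂ) * ft (trunc N f) ξ) atTop
      (𝓝 (∫ ξ, (k t (z - ξ) : ℂ) * F ξ)) := by
    rw [tendsto_iff_edist_tendsto_0]
    refine tendsto_of_tendsto_of_tendsto_of_le_of_le tendsto_const_nhds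
      (h := fun N => eLpNorm (fun ξ => (k t (z - ξ) : ℂ)) p * eLpNorm (F - ft (trunc N f)) q) ?_
      (fun N => zero_le) fun N => ?_
    · exact tendsto_const_mul_zero hkz.2.ne hfF
    · rw [edist_comm, edist_eq_enorm_sub, ← integral_sub]
      · simp_rw [← mul_sub]
        exact enorm_integral_mul_le hkz.1 (hF.sub (hftm N).1)
      · exact hkz.integrable_mul hFm
      · exact hkz.integrable_mul (hftm N)
  have hright : Tendsto (fun N => ft (fun x => m t x * trunc N f x) z) atTop
      (𝓝 (ft (fun x => m t x * f x) z)) := by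
    rw [tendsto_iff_edist_tendsto_0]
    refine tendsto_of_tendsto_of_tendsto_of_le_of_le tendsto_const_nhds
      (h := fun N => eLpNorm (f - trunc N f) p * eLpNorm (fun x => (m t x : ℂ)) q) ?_
      (fun N => zero_le) fun N => ?_
    · simpa using ENNReal.Tendsto.mul_const hlim (Or.inr hmt.2.ne)
    · rw [edist_comm, edist_eq_enorm_sub]
      have := congrFun (ft_sub (hint hf) (hint (memLp_trunc hf N))) z
      rw [Pi.sub_apply] at this
      rw [← this]
      refine (enorm_ft_le _ _).trans ?_
      refine le_trans (le_of_eq ?_)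
        (eLpNorm_one_mul_le (p := p) (q := q) (hf.1.sub (memLp_trunc hf N).1) hmt.1)
      congr 1; ext x
      simp; ring
  refine tendsto_nhds_unique hleft (hright.congr fun N => ?_)
  exact (h.integral_kernel_mul_ft ht (integrable_trunc H.one_le hf N) z).symm

/-- For `s, t > 0` this is Hausdorff–Young applied to `(m s - m t) * f`. If one time is 0, `m 0 * f
= f` may fail to be integrable, and `eLpNorm_sub_ft_le` takes over. -/
theorem eLpNorm_kernelTranslation_sub_le {p q C : ℝ≥0∞} (H : HausdorffYoung p q C) {f F : ℝ → ℂ}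
    (hf : MemLp f p) (hF : AEStronglyMeasurable F) (hfF : HasFT q f F) {s t : ℝ} (hs : 0 ≤ s)
    (ht : 0 ≤ t) :
    eLpNorm (fun x => kernelTranslation k s F x - kernelTranslation k t F x) q ≤
      C * eLpNorm (fun x => ((m s x - m t x : ℝ) : ℂ) * f x) p := by
  have hzero : kernelTranslation k 0 F = F := by ext x; simp [kernelTranslation]
  have hmult : ∀ x, m 0 x = 1 := h.mult_zero
  have hpos : ∀ {r}, 0 < r → kernelTranslation k r F = ft (fun x => m r x * f x) := fun hr => by
    ext z; exact (h.kernelTranslation_eq_ft H hf hF hfF hr z).2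
  have hint : ∀ {r}, 0 < r → Integrable (fun x => m r x * f x) := fun hr =>
    (h.kernelTranslation_eq_ft H hf hF hfF hr 0).1
  rcases hs.eq_or_lt with rfl | hs <;> rcases ht.eq_or_lt with rfl | ht
  · simp
  · rw [hzero, hpos ht]
    refine (H.eLpNorm_sub_ft_le hf hF hfF (hint ht)).trans (le_of_eq ?_)
    congr 2; ext x
    simp [hmult]; ring
  · rw [hzero, hpos hs]
    have := H.eLpNorm_sub_ft_le hf hF hfF (hint hs)
    rw [eLpNorm_sub_comm] at this
    refine this.trans (le_of_eq ?_)
    rw [eLpNorm_sub_comm]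
    congr 2; ext x
    simp [hmult]; ring
  · rw [hpos hs, hpos ht]
    have := H.bound _ ((hint hs).sub (hint ht))
    rw [ft_sub (hint hs) (hint ht)] at this
    refine this.trans (le_of_eq ?_)
    congr 2; ext x
    simp; ring

end IsTranslationKernel

/-! ### Consequences of equivanishing for the translates of transforms -/

theorem exists_pos_mul_ofReal_lt {C : ℝ≥0∞} (hC : C ≠ ∞) {ε : ℝ} (hε : 0 < ε) :
    ∃ η : ℝ, 0 < η ∧ C * ENNReal.ofReal η < ENNReal.ofReal ε := by
  have hc : 0 ≤ C.toReal := ENNReal.toReal_nonneg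
  refine ⟨ε / (C.toReal + 1), by positivity, ?_⟩
  rw [← ENNReal.ofReal_toReal hC, ← ENNReal.ofReal_mul hc, ENNReal.toReal_ofReal hc]
  apply (ENNReal.ofReal_lt_ofReal_iff hε).2
  rw [← mul_div_assoc, div_lt_iff₀ (by positivity)]
  nlinarith

/-- A multiplier bounded by `c` everywhere and by `d` on `[-R, R]`. -/
theorem eLpNorm_mul_le_split {p : ℝ≥0∞} (hp : 1 ≤ p) {f w : ℝ → ℂ} (hf : AEStronglyMeasurable f)
    (hw : AEStronglyMeasurable w) {R c d : ℝ} (hd0 : 0 ≤ d)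
    (hc : ∀ x, ‖w x‖ ≤ c) (hd : ∀ x, |x| ≤ R → ‖w x‖ ≤ d) :
    eLpNorm (fun x => w x * f x) p ≤
      ENNReal.ofReal c * eLpNorm f p (volume.restrict {x | R < |x|}) +
        ENNReal.ofReal d * eLpNorm f p := by
  have hS : MeasurableSet {x : ℝ | R < |x|} := measurableSet_lt (by fun_prop) (by fun_prop)
  set S := {x : ℝ | R < |x|}
  have e : (fun x => w x * f x) = S.indicator (fun x => w x * f x) +
      Sᶜ.indicator (fun x => w x * f x) := (indicator_self_add_compl _ _).symm
  have hwf := hw.mul hf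
  rw [e]
  refine (eLpNorm_add_le (hwf.indicator hS) (hwf.indicator hS.compl) hp).trans ?_
  gcongr
  · rw [eLpNorm_indicator_eq_eLpNorm_restrict hS]
    refine eLpNorm_le_mul_eLpNorm_of_ae_le_mul (Eventually.of_forall fun x => ?_) p
    rw [Pi.mul_apply, norm_mul]
    gcongr
    exact hc x
  · refine eLpNorm_le_mul_eLpNorm_of_ae_le_mul (Eventually.of_forall fun x => ?_) p
    by_cases hx : x ∈ Sᶜ
    · rw [indicator_of_mem hx, Pi.mul_apply, norm_mul]
      gcongr
      exact hd x (not_lt.1 hx)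
    · rw [indicator_of_notMem hx, norm_zero]
      positivity

/-- `K` is equivanishing, for a set of functions on the line. -/
def EquivanishingOn (p : ℝ≥0∞) (K : Set (ℝ → ℂ)) : Prop :=
  ∀ ε : ℝ, 0 < ε → ∃ R : ℝ, 0 < R ∧ ∀ f ∈ K,
    eLpNorm f p (volume.restrict {x | R < |x|}) < ENNReal.ofReal ε

/-- The common device for both continuity properties: the tail of `f` absorbs a multiplier that is
merely bounded, and the norm bound handles the region where it is small. The bound 2 fits a
difference of two unimodular exponentials; with tails below `ε / 4` it costs `ε / 2`. -/
theorem EquivanishingOn.exists_eLpNorm_mul_lt {p : ℝ≥0∞} (hp : 1 ≤ p) {K : Set (ℝ → ℂ)}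
    (hK : EquivanishingOn p K) (hmem : ∀ f ∈ K, AEStronglyMeasurable f) {B : ℝ≥0∞} (hB : B ≠ ∞)
    (hbd : ∀ f ∈ K, eLpNorm f p ≤ B) {ε : ℝ} (hε : 0 < ε) :
    ∃ S, 0 < S ∧ ∃ θ, 0 < θ ∧ ∀ f ∈ K, ∀ w : ℝ → ℂ, AEStronglyMeasurable w → (∀ x, ‖w x‖ ≤ 2) →
      (∀ x, |x| ≤ S → ‖w x‖ ≤ θ) → eLpNorm (fun x => w x * f x) p < ENNReal.ofReal ε := by
  obtain ⟨S, hS, hSK⟩ := hK (ε / 4) (by positivity)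
  obtain ⟨θ, hθ, hθB⟩ := exists_pos_mul_ofReal_lt hB (half_pos hε)
  refine ⟨S, hS, θ, hθ, fun f hf w hw hw2 hwθ => ?_⟩
  refine (eLpNorm_mul_le_split hp (hmem f hf) hw hθ.le hw2 hwθ).trans_lt ?_
  have e : ENNReal.ofReal ε = ENNReal.ofReal 2 * ENNReal.ofReal (ε / 4) + ENNReal.ofReal (ε / 2) := by
    rw [← ENNReal.ofReal_mul (by norm_num), ← ENNReal.ofReal_add (by positivity) (by positivity)]
    congr 1; ring
  rw [e]
  refine ENNReal.add_lt_add_of_le_of_lt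
    (ENNReal.mul_ne_top (by simp) ((hSK f hf).trans_le le_top).ne) ?_ ?_
  · gcongr
    exact (hSK f hf).le
  · rw [mul_comm]
    exact (mul_le_mul_left (hbd f hf) _).trans_lt hθB

theorem norm_kernel_sub_le (u v : ℝ) :
    ‖Complex.exp (-(Complex.I * (u : ℂ))) - Complex.exp (-(Complex.I * (v : ℂ)))‖ ≤ |u - v| := by
  have e : Complex.exp (-(Complex.I * (u : ℂ))) - Complex.exp (-(Complex.I * (v : ℂ))) =
      Complex.exp (-(Complex.I * (v : ℂ))) * (Complex.exp (Complex.I * ((v - u : ℝ) : ℂ)) - 1) := by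
    rw [mul_sub, ← Complex.exp_add, mul_one]
    congr 2
    push_cast; ring
  rw [e, norm_mul, norm_kernel, one_mul, abs_sub_comm]
  exact Real.norm_exp_I_mul_ofReal_sub_one_le

namespace IsTranslationKernel

variable {k m : ℝ → ℝ → ℝ} (h : IsTranslationKernel k m)
include h

theorem exists_eLpNorm_translation_sub_lt {p q C : ℝ≥0∞} (H : HausdorffYoung p q C)
    {K : Set (ℝ → ℂ)} (hmem : ∀ f ∈ K, MemLp f p) {B : ℝ≥0∞} (hB : B ≠ ∞)
    (hbd : ∀ f ∈ K, eLpNorm f p ≤ B) (hK : EquivanishingOn p K) {ε : ℝ} (hε : 0 < ε) :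
    ∃ δ, 0 < δ ∧ ∀ s t, 0 ≤ s → 0 ≤ t → |s - t| ≤ δ → ∀ f ∈ K, ∀ F, AEStronglyMeasurable F →
      HasFT q f F → eLpNorm (fun x => kernelTranslation k s F x - kernelTranslation k t F x) q <
        ENNReal.ofReal ε := by
  obtain ⟨η, hη, hηε⟩ := exists_pos_mul_ofReal_lt H.const_ne_top hε
  obtain ⟨S, hS, θ, hθ, hw⟩ := hK.exists_eLpNorm_mul_lt H.one_le (fun f hf => (hmem f hf).1) hB hbd hη
  obtain ⟨L, hL, hLip⟩ := h.mult_lipschitz S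
  -- The added 1 keeps the quotient meaningful when `L = 0`. The Lipschitz constant is uniform in
  -- time, hence so is `δ`.
  refine ⟨θ / (L + 1), by positivity, fun s t hs ht hst f hf F hF hfF => ?_⟩
  refine (h.eLpNorm_kernelTranslation_sub_le H (hmem f hf) hF hfF hs ht).trans_lt ?_
  refine lt_of_le_of_lt ?_ hηε
  gcongr
  refine (hw f hf _ ?_ ?_ ?_).le
  · exact (Complex.continuous_ofReal.comp
      ((h.mult_continuous s).sub (h.mult_continuous t))).aestronglyMeasurable
  · intro x
    rw [Complex.norm_real, Real.norm_eq_abs, abs_le]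
    constructor <;> linarith [h.mult_nonneg s x, h.mult_nonneg t x, h.mult_le_one s hs x,
      h.mult_le_one t ht x]
  · intro x hx
    rw [Complex.norm_real, Real.norm_eq_abs]
    refine (hLip s t hs ht x hx).trans ?_
    rw [le_div_iff₀ (by positivity)] at hst
    nlinarith [abs_nonneg (s - t)]

theorem norm_ft_mult_mul_le {p q C : ℝ≥0∞} (H : HausdorffYoung p q C) {g : ℝ → ℂ}
    (hg : AEStronglyMeasurable g) {A : ℝ} {t : ℝ} {M : ℝ}
    (hA : eLpNorm (fun x => (m t x : ℂ)) q ≤ ENNReal.ofReal A) (hA0 : 0 ≤ A)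
    (hM : eLpNorm g p ≤ ENNReal.ofReal M) (hM0 : 0 ≤ M) :
    ‖∫ x, (m t x : ℂ) * g x‖ ≤ A * M := by
  have := H.conj.symm
  have h1 := enorm_integral_mul_le (p := q) (q := p) (f := fun x => (m t x : ℂ))
    (Complex.continuous_ofReal.comp (h.mult_continuous t)).aestronglyMeasurable hg
  have h2 := h1.trans (mul_le_mul' hA hM)
  rw [← ofReal_norm, ← ENNReal.ofReal_mul hA0, ENNReal.ofReal_le_ofReal_iff (by positivity)] at h2
  exact h2

theorem measurable_kernelTranslation {F : ℝ → ℂ} (hF : Measurable F) (x : ℝ) :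
    Measurable fun t => kernelTranslation k t F x := by
  unfold kernelTranslation
  refine Measurable.ite (measurableSet_singleton _) measurable_const ?_
  have : Measurable (Function.uncurry fun t ξ => (k t (x - ξ) : ℂ) * F ξ) := by
    refine Measurable.mul ?_ (hF.comp measurable_snd)
    refine Complex.measurable_ofReal.comp ?_
    exact h.measurable.comp (measurable_fst.prodMk (measurable_const.sub measurable_snd))
  exact (this.stronglyMeasurable.integral_prod_right).measurable

/-- Hölder gives the increment of `T^t F` a factor `1 + t ^ (-1/2)`, so integrability of that weight
against `ν` is exactly what lets the estimate survive averaging down to `t = 0`. -/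
theorem exists_norm_translationMean_sub_lt {p q C : ℝ≥0∞} (H : HausdorffYoung p q C)
    {K : Set (ℝ → ℂ)} (hmem : ∀ f ∈ K, MemLp f p) {B : ℝ≥0∞} (hB : B ≠ ∞)
    (hbd : ∀ f ∈ K, eLpNorm f p ≤ B) (hK : EquivanishingOn p K) {ν : Measure ℝ} {a : ℝ}
    (hν : IntegrableOn (fun t : ℝ => 1 + t ^ (-(1 / 2) : ℝ)) (Ioo 0 a) ν) (R : ℝ)
    {ε : ℝ} (hε : 0 < ε) :
    ∃ δ, 0 < δ ∧ ∀ r, |r| ≤ δ → ∀ f ∈ K, ∀ F, Measurable F → HasFT q f F →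
      ∀ x, |x| < R → |x + r| < R →
        ‖translationMean (kernelTranslation k) ν a R F (x + r) -
          translationMean (kernelTranslation k) ν a R F x‖ < ε := by
  obtain ⟨A, hA, hAt⟩ := h.exists_eLpNorm_mult_le H.two_le
  set c : ℝ := (ν (Ioo 0 a)).toReal⁻¹ with hc
  have hc0 : 0 ≤ c := by positivity
  set J : ℝ := ∫ t in Ioo 0 a, (1 + t ^ (-(1 / 2) : ℝ)) ∂ν with hJ
  have hJ0 : 0 ≤ J := setIntegral_nonneg measurableSet_Ioo fun t ht => by
    have := ht.1
    positivity
  have hD : 0 < c * (A * J) + 1 := by positivity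
  set η := ε / (c * (A * J) + 1) with hη
  have hη0 : 0 < η := by positivity
  obtain ⟨S, hS, θ, hθ, hw⟩ := hK.exists_eLpNorm_mul_lt H.one_le (fun f hf => (hmem f hf).1) hB hbd hη0
  -- For `|y| ≤ S` the exponentials at `x + r` and `x` differ by at most `|y| * |r| ≤ S * (θ / S) =
  -- θ`.
  refine ⟨θ / S, by positivity, fun r hr f hf F hF hfF x hx hxr => ?_⟩
  have hform : ∀ t, 0 < t → ∀ z, kernelTranslation k t F z =
      ∫ y, (m t y : ℂ) * (Complex.exp (-(Complex.I * ((y * z : ℝ) : ℂ))) * f y) := by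
    intro t ht z
    rw [(h.kernelTranslation_eq_ft H (hmem f hf) hF.aestronglyMeasurable hfF ht z).2, ft]
    congr 1; ext y; ring
  have hE : ∀ z : ℝ, Continuous fun y : ℝ => Complex.exp (-(Complex.I * ((y * z : ℝ) : ℂ))) := by
    intro z; fun_prop
  have hkf : ∀ z : ℝ, AEStronglyMeasurable fun y : ℝ =>
      Complex.exp (-(Complex.I * ((y * z : ℝ) : ℂ))) * f y := fun z =>
    (hE z).aestronglyMeasurable.mul (hmem f hf).1
  have hbound : ∀ t, 0 < t → ∀ z, ‖kernelTranslation k t F z‖ ≤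
      (A * (1 + t ^ (-(1 / 2) : ℝ))) * B.toReal := by
    intro t ht z
    rw [hform t ht z]
    refine h.norm_ft_mult_mul_le H (hkf z) (hAt t ht) (by positivity) ?_ (by positivity)
    rw [ENNReal.ofReal_toReal hB]
    refine le_trans (le_of_eq ?_) (hbd f hf)
    exact eLpNorm_congr_norm_ae (Eventually.of_forall fun y => by rw [norm_mul, norm_kernel, one_mul])
  -- Without integrability in `t`, the difference of the means could not be written as the mean of
  -- the differences.
  have hint : ∀ z, IntegrableOn (fun t => kernelTranslation k t F z) (Ioo 0 a) ν := by
    intro z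
    refine Integrable.mono' ((hν.const_mul A).mul_const B.toReal)
      (h.measurable_kernelTranslation hF z).aestronglyMeasurable ?_
    filter_upwards [ae_restrict_mem measurableSet_Ioo] with t ht
    exact hbound t ht.1 z
  have hdiff : ∀ t, 0 < t → ‖kernelTranslation k t F (x + r) - kernelTranslation k t F x‖ ≤
      (A * (1 + t ^ (-(1 / 2) : ℝ))) * η := by
    intro t ht
    have hi : ∀ z, Integrable fun y =>
        (m t y : ℂ) * (Complex.exp (-(Complex.I * ((y * z : ℝ) : ℂ))) * f y) := by
      intro z
      have := integrable_mul_kernel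
        (h.kernelTranslation_eq_ft H (hmem f hf) hF.aestronglyMeasurable hfF ht z).1 z
      refine this.congr (Eventually.of_forall fun y => ?_)
      ring
    rw [hform t ht, hform t ht, ← integral_sub (hi _) (hi _)]
    simp_rw [← mul_sub, ← sub_mul]
    refine h.norm_ft_mult_mul_le H
      (((hE _).sub (hE _)).aestronglyMeasurable.mul (hmem f hf).1) (hAt t ht) (by positivity)
      (hw f hf _ ((hE _).sub (hE _)).aestronglyMeasurable ?_ ?_).le hη0.le
    · intro y
      refine (norm_sub_le _ _).trans ?_
      rw [norm_kernel, norm_kernel]; norm_num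
    · intro y hy
      refine (norm_kernel_sub_le _ _).trans ?_
      rw [← mul_sub, add_sub_cancel_left, abs_mul]
      rw [le_div_iff₀ hS] at hr
      nlinarith [abs_nonneg r, abs_nonneg y]
  rw [translationMean, translationMean, if_pos hx, if_pos hxr, ← mul_sub,
    ← integral_sub (hint _) (hint _), norm_mul, norm_inv, Complex.norm_real,
    Real.norm_of_nonneg ENNReal.toReal_nonneg]
  have hle : ‖∫ t in Ioo 0 a, (kernelTranslation k t F (x + r) - kernelTranslation k t F x) ∂ν‖ ≤
      A * J * η := by
    rw [hJ, ← integral_const_mul, ← integral_mul_const]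
    refine norm_integral_le_of_norm_le ((hν.const_mul A).mul_const η) ?_
    filter_upwards [ae_restrict_mem measurableSet_Ioo] with t ht
    exact hdiff t ht.1
  calc _ ≤ c * (A * J * η) := by rw [← hc]; gcongr
    _ = (c * (A * J)) * η := by ring
    _ < ε := by
      rw [hη, ← mul_div_assoc, div_lt_iff₀ hD]
      nlinarith

end IsTranslationKernel

/-! ### The converse: continuity of translates gives small tails of transforms -/

namespace IsTranslationKernel

variable {k m : ℝ → ℝ → ℝ} (h : IsTranslationKernel k m)
include h

open Convolution in
omit h in
theorem kernelTranslation_eq_convolution {t : ℝ} (ht : 0 < t) (g : ℝ → ℂ) :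
    kernelTranslation k t g = (fun u => (k t u : ℂ)) ⋆[ContinuousLinearMap.mul ℂ ℂ, volume] g := by
  ext x
  rw [kernelTranslation, if_neg ht.ne', convolution_mul_swap]

theorem integrable_kernelTranslation {t : ℝ} (ht : 0 < t) {g : ℝ → ℂ} (hg : Integrable g) :
    Integrable (kernelTranslation k t g) := by
  rw [kernelTranslation_eq_convolution ht]
  exact (h.integrable t ht).ofReal.integrable_convolution _ hg

theorem ft_kernelTranslation {t : ℝ} (ht : 0 < t) {g : ℝ → ℂ} (hg : Integrable g) (z : ℝ) :
    ft (kernelTranslation k t g) z = m t z * ft g z := by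
  rw [← h.ft_eq t ht, kernelTranslation_eq_convolution ht]
  simp_rw [ft_eq_fourier]
  exact Real.fourier_mul_convolution_eq (h.integrable t ht).ofReal hg _

theorem measurable_kernelTranslation_right {t : ℝ} (ht : 0 < t) {g : ℝ → ℂ} (hg : Measurable g) :
    Measurable (kernelTranslation k t g) := by
  have e : kernelTranslation k t g = fun x => ∫ ξ, (k t (x - ξ) : ℂ) * g ξ := by
    ext x; rw [kernelTranslation, if_neg ht.ne']
  rw [e]
  have : Measurable (Function.uncurry fun x ξ => (k t (x - ξ) : ℂ) * g ξ) := by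
    refine Measurable.mul ?_ (hg.comp measurable_snd)
    refine Complex.measurable_ofReal.comp ?_
    exact h.measurable.comp (measurable_const.prodMk (measurable_fst.sub measurable_snd))
  exact (this.stronglyMeasurable.integral_prod_right).measurable

theorem lintegral_kernel {t : ℝ} (ht : 0 < t) : ∫⁻ u, ENNReal.ofReal (k t u) = 1 := by
  rw [← ofReal_integral_eq_lintegral_ofReal (h.integrable t ht)
    (Eventually.of_forall (h.nonneg t ht)), h.integral_eq_one t ht, ENNReal.ofReal_one]

/-- Averaging against a probability density does not increase the `L^p` norm. -/
theorem eLpNorm_kernelTranslation_le {t : ℝ} (ht : 0 < t) {p : ℝ≥0∞} (hp : 1 ≤ p) (hp' : p ≠ ∞)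
    {g : ℝ → ℂ} (hg : Measurable g) : eLpNorm (kernelTranslation k t g) p ≤ eLpNorm g p := by
  have hp0 : p ≠ 0 := (zero_lt_one.trans_le hp).ne'
  have hpr : 0 < p.toReal := ENNReal.toReal_pos hp0 hp'
  have hkm : Measurable (fun y : ℝ × ℝ => ENNReal.ofReal (k t (y.1 - y.2))) :=
    ENNReal.measurable_ofReal.comp
      (h.measurable.comp (measurable_const.prodMk (measurable_fst.sub measurable_snd)))
  have hkx : ∀ x, Measurable fun ξ => ENNReal.ofReal (k t (x - ξ)) := fun x =>
    hkm.comp (measurable_const.prodMk measurable_id)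
  have hkξ : ∀ ξ, Measurable fun x => ENNReal.ofReal (k t (x - ξ)) := fun ξ =>
    hkm.comp (measurable_id.prodMk measurable_const)
  have hpt : ∀ x, ‖kernelTranslation k t g x‖ₑ ^ p.toReal ≤
      ∫⁻ ξ, ENNReal.ofReal (k t (x - ξ)) * ‖g ξ‖ₑ ^ p.toReal := by
    intro x
    -- The reflected, shifted kernel is a probability density, so Jensen's inequality is the
    -- monotonicity of `L^p` norms for `μ`. Tonelli then integrates the kernel out in `x`.
    set μ := volume.withDensity fun ξ => ENNReal.ofReal (k t (x - ξ)) with hμ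
    have : IsProbabilityMeasure μ := by
      constructor
      rw [hμ, withDensity_apply _ MeasurableSet.univ, Measure.restrict_univ,
        lintegral_sub_left_eq_self (fun u => ENNReal.ofReal (k t u)), h.lintegral_kernel ht]
    have h1 := eLpNorm_le_eLpNorm_of_exponent_le (μ := μ) hp hg.aestronglyMeasurable
    rw [eLpNorm_one_eq_lintegral_enorm, eLpNorm_eq_lintegral_rpow_enorm_toReal hp0 hp',
      one_div, ENNReal.le_rpow_inv_iff hpr, hμ,
      lintegral_withDensity_eq_lintegral_mul _ (hkx x) hg.enorm,
      lintegral_withDensity_eq_lintegral_mul _ (hkx x) (hg.enorm.pow_const _)] at h1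
    refine le_trans ?_ h1
    gcongr
    rw [kernelTranslation, if_neg ht.ne']
    refine (enorm_integral_le_lintegral_enorm _).trans (le_of_eq ?_)
    congr 1; ext ξ
    rw [enorm_mul, Pi.mul_apply, ← ofReal_norm (k t (x - ξ) : ℂ), Complex.norm_real,
      Real.norm_of_nonneg (h.nonneg t ht _)]
  rw [eLpNorm_eq_lintegral_rpow_enorm_toReal hp0 hp', eLpNorm_eq_lintegral_rpow_enorm_toReal hp0 hp']
  gcongr ?_ ^ _
  calc _ ≤ ∫⁻ x, ∫⁻ ξ, ENNReal.ofReal (k t (x - ξ)) * ‖g ξ‖ₑ ^ p.toReal := lintegral_mono hpt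
    _ = ∫⁻ ξ, ∫⁻ x, ENNReal.ofReal (k t (x - ξ)) * ‖g ξ‖ₑ ^ p.toReal := by
      apply lintegral_lintegral_swap
      exact (hkm.mul ((hg.comp measurable_snd).enorm.pow_const _)).aemeasurable
    _ = ∫⁻ ξ, ‖g ξ‖ₑ ^ p.toReal := by
      congr 1; ext ξ
      rw [lintegral_mul_const _ (hkξ ξ),
        lintegral_sub_right_eq_self (fun u => ENNReal.ofReal (k t u)), h.lintegral_kernel ht, one_mul]

theorem kernelTranslation_sub {p q C : ℝ≥0∞} (H : HausdorffYoung p q C) {t : ℝ} (ht : 0 < t)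
    {f g : ℝ → ℂ} (hf : MemLp f p) (hg : MemLp g p) :
    kernelTranslation k t (f - g) = kernelTranslation k t f - kernelTranslation k t g := by
  have := H.conj.symm
  ext x
  simp only [kernelTranslation, if_neg ht.ne', Pi.sub_apply, mul_sub]
  exact integral_sub ((h.memLp_sub ht H.one_le_conj x).integrable_mul hf)
    ((h.memLp_sub ht H.one_le_conj x).integrable_mul hg)

/-- Formally `(m t - 1) * F` is the transform of `T^t f - f`. The convolution theorem needs
integrability, so it is applied to truncations; the error is one tail of the transform and, as `T^t`
is an `L^p` contraction, two tails of `f`. -/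
theorem eLpNorm_one_sub_mult_mul_le {p q C : ℝ≥0∞} (H : HausdorffYoung p q C) {f F : ℝ → ℂ}
    (hfm : Measurable f) (hf : MemLp f p) (hF : AEStronglyMeasurable F) (hfF : HasFT q f F) {t : ℝ}
    (ht : 0 < t) :
    eLpNorm (fun x => ((m t x - 1 : ℝ) : ℂ) * F x) q ≤
      C * eLpNorm (fun x => kernelTranslation k t f x - f x) p := by
  set D := eLpNorm (fun x => kernelTranslation k t f x - f x) p with hD
  set w : ℝ → ℂ := fun x => ((m t x - 1 : ℝ) : ℂ) with hw
  have hwc : Continuous w := by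
    have := h.mult_continuous t
    fun_prop
  have hw1 : ∀ x, ‖w x‖ ≤ 1 := fun x => by
    rw [hw, Complex.norm_real, Real.norm_eq_abs, abs_le]
    constructor <;> linarith [h.mult_nonneg t x, h.mult_le_one t ht.le x]
  have hlim := tendsto_eLpNorm_sub_trunc H.ne_zero H.ne_top hf
  have h3 : Tendsto (fun N => eLpNorm (F - ft (trunc N f)) q +
      C * (D + (eLpNorm (f - trunc N f) p + eLpNorm (f - trunc N f) p))) atTop
      (𝓝 (0 + C * (D + (0 + 0)))) :=
    hfF.add (ENNReal.Tendsto.const_mul (tendsto_const_nhds.add (hlim.add hlim)) (Or.inr H.const_ne_top))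
  rw [zero_add, add_zero, add_zero] at h3
  refine ge_of_tendsto' h3 fun N => ?_
  have hN := integrable_trunc H.one_le hf N
  have hNm : Measurable (trunc N f) := hfm.indicator measurableSet_Ioc
  have hTm : ∀ {g : ℝ → ℂ}, Measurable g → AEStronglyMeasurable (kernelTranslation k t g) := fun hg =>
    (h.measurable_kernelTranslation_right ht hg).aestronglyMeasurable
  have e1 : (fun x => w x * F x) = (fun x => w x * (F - ft (trunc N f)) x) +
      ft (kernelTranslation k t (trunc N f) - trunc N f) := by
    rw [ft_sub (h.integrable_kernelTranslation ht hN) hN]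
    ext x
    simp only [Pi.add_apply, Pi.sub_apply, h.ft_kernelTranslation ht hN, hw]
    push_cast; ring
  have hFN := hF.sub (continuous_ft hN).aestronglyMeasurable
  rw [e1]
  refine (eLpNorm_add_le (hwc.aestronglyMeasurable.mul hFN) (continuous_ft
    ((h.integrable_kernelTranslation ht hN).sub hN)).aestronglyMeasurable H.one_le_conj).trans ?_
  gcongr
  · refine eLpNorm_mono fun x => ?_
    rw [Pi.mul_apply, norm_mul]
    exact mul_le_of_le_one_left (norm_nonneg _) (hw1 x)
  refine (H.bound _ ((h.integrable_kernelTranslation ht hN).sub hN)).trans ?_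
  gcongr
  have e2 : kernelTranslation k t (trunc N f) - trunc N f =
      (fun x => kernelTranslation k t f x - f x) -
        (kernelTranslation k t (f - trunc N f) - (f - trunc N f)) := by
    rw [h.kernelTranslation_sub H ht hf (memLp_trunc hf N)]
    ext x
    simp only [Pi.sub_apply]
    ring
  rw [e2]
  have hm1 : AEStronglyMeasurable (fun x => kernelTranslation k t f x - f x) :=
    (hTm hfm).sub hfm.aestronglyMeasurable
  have hm2 := (hfm.sub hNm)
  refine (eLpNorm_sub_le hm1 ((hTm hm2).sub hm2.aestronglyMeasurable) H.one_le).trans ?_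
  gcongr
  refine (eLpNorm_sub_le (hTm hm2) hm2.aestronglyMeasurable H.one_le).trans ?_
  gcongr
  exact h.eLpNorm_kernelTranslation_le ht H.one_le H.ne_top hm2

/-- Where `m t ≤ 1/2`, `|F| ≤ 2 * |(m t - 1) * F|`. The order of quantifiers matters: `η` depends on
`ε` alone, so the time `t` can be chosen from `η` before `R` is chosen from `t`. -/
theorem exists_eLpNorm_restrict_lt {p q C : ℝ≥0∞} (H : HausdorffYoung p q C) {ε : ℝ} (hε : 0 < ε) :
    ∃ η, 0 < η ∧ ∀ t, 0 < t → ∃ R, 0 < R ∧ ∀ f F : ℝ → ℂ, Measurable f → MemLp f p →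
      AEStronglyMeasurable F → HasFT q f F →
      eLpNorm (fun x => kernelTranslation k t f x - f x) p < ENNReal.ofReal η →
      eLpNorm F q (volume.restrict {x | R < |x|}) < ENNReal.ofReal ε := by
  obtain ⟨η, hη, hηε⟩ := exists_pos_mul_ofReal_lt
    (ENNReal.mul_ne_top ENNReal.ofReal_ne_top H.const_ne_top : ENNReal.ofReal 2 * C ≠ ∞) hε
  refine ⟨η, hη, fun t ht => ?_⟩
  obtain ⟨R, hR, hm⟩ := h.mult_decay t ht
  refine ⟨R, hR, fun f F hfm hf hF hfF hlt => lt_of_le_of_lt ?_ hηε⟩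
  have hS : MeasurableSet {x : ℝ | R < |x|} := measurableSet_lt (by fun_prop) (by fun_prop)
  have h1 : eLpNorm F q (volume.restrict {x | R < |x|}) ≤ ENNReal.ofReal 2 *
      eLpNorm (fun x => ((m t x - 1 : ℝ) : ℂ) * F x) q (volume.restrict {x | R < |x|}) := by
    refine eLpNorm_le_mul_eLpNorm_of_ae_le_mul ?_ q
    filter_upwards [ae_restrict_mem hS] with x hx
    rw [norm_mul, Complex.norm_real, Real.norm_eq_abs, abs_sub_comm,
      abs_of_nonneg (by linarith [hm x hx])]
    nlinarith [hm x hx, norm_nonneg (F x)]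
  refine h1.trans ?_
  rw [mul_assoc]
  gcongr
  refine (eLpNorm_mono_measure _ Measure.restrict_le_self).trans ?_
  refine (h.eLpNorm_one_sub_mult_mul_le H hfm hf hF hfF ht).trans ?_
  gcongr

end IsTranslationKernel

/-! ### Elementary estimates for the multipliers -/

theorem abs_exp_neg_sub_exp_neg_le {u v : ℝ} (hu : 0 ≤ u) (hv : 0 ≤ v) :
    |Real.exp (-u) - Real.exp (-v)| ≤ |u - v| := by
  wlog huv : u ≤ v generalizing u v
  · rw [abs_sub_comm, abs_sub_comm u]
    exact this hv hu (le_of_not_ge huv)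
  have h1 : Real.exp (-v) ≤ Real.exp (-u) := Real.exp_le_exp.2 (by linarith)
  rw [abs_of_nonneg (by linarith), abs_of_nonpos (by linarith)]
  have h2 : Real.exp (-v) = Real.exp (-u) * Real.exp (u - v) := by
    rw [← Real.exp_add]; congr 1; ring
  have h3 := Real.add_one_le_exp (u - v)
  have h4 : Real.exp (-u) ≤ 1 := Real.exp_le_one_iff.2 (by linarith)
  have h5 := Real.exp_pos (-u)
  rw [h2]
  nlinarith

theorem exp_neg_le_half {y : ℝ} (hy : 1 ≤ y) : Real.exp (-y) ≤ 1 / 2 := by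
  have := Real.add_one_le_exp y
  rw [Real.exp_neg, one_div]
  exact inv_anti₀ (by norm_num) (by linarith)

theorem eLpNorm_two_le {f : ℝ → ℝ} (hf : Continuous f) {I A : ℝ} (hi : Integrable fun x => f x ^ 2)
    (hI : ∫ x, f x ^ 2 ≤ I) (hA : I ≤ A ^ 2) (hA0 : 0 ≤ A) :
    eLpNorm f 2 ≤ ENNReal.ofReal A := by
  have hm : MemLp f 2 := (memLp_two_iff_integrable_sq hf.aestronglyMeasurable).2 hi
  rw [hm.eLpNorm_eq_integral_rpow_norm (by norm_num) (by norm_num)]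
  apply ENNReal.ofReal_le_ofReal
  have e : ∀ x, ‖f x‖ ^ (2 : ℝ≥0∞).toReal = f x ^ 2 := fun x => by simp
  simp_rw [e]
  have : (2 : ℝ≥0∞).toReal⁻¹ = 1 / 2 := by norm_num
  rw [this, ← Real.sqrt_eq_rpow]
  exact Real.sqrt_le_iff.2 ⟨hA0, hI.trans hA⟩

theorem integral_eq_of_ft_zero {k : ℝ → ℝ} {c : ℝ} (h : ft (fun u => (k u : ℂ)) 0 = c) :
    ∫ u, k u = c := by
  simp only [ft, mul_zero, Complex.ofReal_zero, neg_zero, Complex.exp_zero, mul_one] at h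
  rw [integral_complex_ofReal] at h
  exact_mod_cast h

/-! ### The heat kernel -/

/-- The fundamental solution of `u_t = b² u_xx`. -/
noncomputable def heatKernel (b t u : ℝ) : ℝ :=
  Real.exp (-u ^ 2 / (4 * b ^ 2 * t)) / (2 * b * Real.sqrt Real.pi * Real.sqrt t)

theorem heatTranslation_eq (b : ℝ) : heatTranslation b = kernelTranslation (heatKernel b) := rfl

theorem ft_heatKernel {b t : ℝ} (hb : 0 < b) (ht : 0 < t) (x : ℝ) :
    ft (fun u => (heatKernel b t u : ℂ)) x = (Real.exp (-(b ^ 2 * t * x ^ 2)) : ℝ) := by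
  set β : ℝ := 1 / (4 * b ^ 2 * t) with hβ
  have hβ0 : 0 < β := by positivity
  have h1 := fourierIntegral_gaussian (b := (β : ℂ)) (by simpa using hβ0) (-(x : ℂ))
  set c : ℝ := 2 * b * Real.sqrt Real.pi * Real.sqrt t with hc
  have hc0 : 0 < c := by have := Real.pi_pos; positivity
  -- The Gaussian integral `√(π / β)` equals the normalizing constant `c` of the heat kernel, so the
  -- two cancel.
  have hsq : ((Real.pi : ℂ) / β) ^ (1 / 2 : ℂ) = (c : ℝ) := by
    have : ((Real.pi : ℂ) / β) ^ (1 / 2 : ℂ) = ((Real.pi / β) ^ (1 / 2 : ℝ) : ℝ) := by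
      rw [Complex.ofReal_cpow (by have := Real.pi_pos; positivity)]
      push_cast; rfl
    rw [this, ← Real.sqrt_eq_rpow, Complex.ofReal_inj,
      Real.sqrt_eq_iff_mul_self_eq (by have := Real.pi_pos; positivity) hc0.le, hc, hβ]
    have e1 := Real.mul_self_sqrt Real.pi_pos.le
    have e2 := Real.mul_self_sqrt ht.le
    symm
    calc _ = 4 * b ^ 2 * (Real.sqrt Real.pi * Real.sqrt Real.pi) * (Real.sqrt t * Real.sqrt t) := by ring
      _ = _ := by rw [e1, e2]; field_simp
  rw [hsq] at h1
  have h2 : ∀ u : ℝ, (heatKernel b t u : ℂ) * Complex.exp (-(Complex.I * ((u * x : ℝ) : ℂ))) =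
      (c : ℂ)⁻¹ * (Complex.exp (Complex.I * (-(x : ℂ)) * u) * Complex.exp (-(β : ℂ) * u ^ 2)) := by
    intro u
    have e3 : heatKernel b t u = c⁻¹ * Real.exp (-β * u ^ 2) := by
      rw [heatKernel, ← hc, hβ, div_eq_inv_mul]
      congr 2
      field_simp
    have e4 : -(Complex.I * ((u * x : ℝ) : ℂ)) = Complex.I * (-(x : ℂ)) * u := by push_cast; ring
    rw [e3, e4]
    push_cast; ring
  rw [ft]
  simp_rw [h2]
  rw [integral_const_mul, h1, inv_mul_cancel_left₀ (by exact_mod_cast hc0.ne'), Complex.ofReal_exp]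
  congr 1
  have hb' : (b : ℂ) ≠ 0 := by exact_mod_cast hb.ne'
  have ht' : (t : ℂ) ≠ 0 := by exact_mod_cast ht.ne'
  rw [hβ]
  push_cast
  field_simp

theorem isTranslationKernel_heat {b : ℝ} (hb : 0 < b) :
    IsTranslationKernel (heatKernel b) fun t x => Real.exp (-(b ^ 2 * t * x ^ 2)) where
  measurable := by
    unfold heatKernel Function.uncurry
    fun_prop
  nonneg t ht u := by unfold heatKernel; positivity
  bdd t ht := by
    refine ⟨1 / (2 * b * Real.sqrt Real.pi * Real.sqrt t), fun u => ?_⟩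
    unfold heatKernel
    gcongr
    rw [Real.exp_le_one_iff]
    exact div_nonpos_of_nonpos_of_nonneg (by nlinarith [sq_nonneg u]) (by positivity)
  integrable t ht := by
    have := (integrable_exp_neg_mul_sq (b := 1 / (4 * b ^ 2 * t)) (by positivity)).div_const
      (2 * b * Real.sqrt Real.pi * Real.sqrt t)
    refine this.congr (Eventually.of_forall fun u => ?_)
    simp only [heatKernel]
    congr 2
    field_simp
  integral_eq_one t ht := integral_eq_of_ft_zero (by rw [ft_heatKernel hb ht]; simp)
  ft_eq t ht x := ft_heatKernel hb ht x
  mult_neg t x := by simp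
  mult_nonneg t x := (Real.exp_pos _).le
  mult_le_one t ht x := Real.exp_le_one_iff.2 (neg_nonpos.2 (by positivity))
  mult_zero x := by simp
  mult_continuous t := by fun_prop
  mult_lipschitz R := by
    refine ⟨b ^ 2 * R ^ 2, by positivity, fun s t hs ht x hx => ?_⟩
    refine (abs_exp_neg_sub_exp_neg_le (by positivity) (by positivity)).trans ?_
    rw [show b ^ 2 * s * x ^ 2 - b ^ 2 * t * x ^ 2 = b ^ 2 * x ^ 2 * (s - t) by ring, abs_mul,
      abs_of_nonneg (by positivity)]
    gcongr b ^ 2 * ?_ * _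
    exact sq_le_sq' (by linarith [abs_le.1 hx]) (abs_le.1 hx).2
  mult_decay t ht := by
    -- Beyond 1 one has `|x| ^ 2 ≥ |x|`, which avoids a square root in the radius.
    refine ⟨1 + 1 / (b ^ 2 * t), by positivity, fun x hx => exp_neg_le_half ?_⟩
    have h1 : 1 ≤ |x| := le_trans (by linarith [show 0 ≤ 1 / (b ^ 2 * t) by positivity]) hx.le
    have h2 : 1 / (b ^ 2 * t) ≤ |x| ^ 2 := by nlinarith
    rwa [sq_abs, div_le_iff₀ (by positivity), mul_comm] at h2
  mult_sq := by
    set c := Real.sqrt (Real.pi / (2 * b ^ 2)) with hc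
    -- The squared norm is `c * t ^ (-1/2)`, so the norm is only of order `t ^ (-1/4)`; the weaker
    -- common bound suffices.
    refine ⟨1 + c, by positivity, fun t ht => ?_⟩
    have e : ∀ x : ℝ, Real.exp (-(b ^ 2 * t * x ^ 2)) ^ 2 = Real.exp (-(2 * b ^ 2 * t) * x ^ 2) := by
      intro x
      rw [pow_two, ← Real.exp_add]; congr 1; ring
    have hs : (0 : ℝ) ≤ t ^ (-(1 / 2) : ℝ) := by positivity
    have hc0 : 0 ≤ c := Real.sqrt_nonneg _
    refine eLpNorm_two_le (I := c * t ^ (-(1 / 2) : ℝ)) (by fun_prop) ?_ ?_ ?_ (by positivity)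
    · simp_rw [e]
      exact integrable_exp_neg_mul_sq (by positivity)
    · simp_rw [e]
      rw [integral_gaussian, ← div_div, Real.sqrt_div' _ ht.le, ← hc, Real.rpow_neg ht.le,
        ← Real.sqrt_eq_rpow, div_eq_mul_inv]
    · nlinarith [mul_nonneg hc0 hs, mul_nonneg (mul_nonneg hc0 hs) (mul_nonneg hc0 hs)]

/-! ### The Poisson kernel -/

/-- The Poisson kernel of the upper half-plane. -/
noncomputable def poissonKernel (t u : ℝ) : ℝ := 1 / Real.pi * (t / (u ^ 2 + t ^ 2))

theorem harmonicTranslation_eq : harmonicTranslation = kernelTranslation poissonKernel := by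
  ext t f x
  simp only [harmonicTranslation, kernelTranslation, poissonKernel]
  congr 2; ext ξ
  rw [show (ξ - x) ^ 2 = (x - ξ) ^ 2 by ring]

theorem integrable_exp_neg_mul_abs {t : ℝ} (ht : 0 < t) :
    Integrable fun x : ℝ => Real.exp (-(t * |x|)) := by
  rw [← integrableOn_univ, ← Iic_union_Ioi (a := (0 : ℝ))]
  refine IntegrableOn.union ?_ ?_
  · exact (integrableOn_exp_mul_Iic ht 0).congr_fun
      (fun x hx => by simp [abs_of_nonpos (mem_Iic.1 hx)]) measurableSet_Iic
  · exact (exp_neg_integrableOn_Ioi 0 ht).congr_fun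
      (fun x hx => by simp [abs_of_pos (mem_Ioi.1 hx)]) measurableSet_Ioi

/-- An explicit integral of one exponential on each half-line; the transform of the Poisson kernel
follows from it by inversion. -/
theorem ft_exp_neg_mul_abs {t : ℝ} (ht : 0 < t) (z : ℝ) :
    ft (fun x => (Real.exp (-(t * |x|)) : ℂ)) z = ((2 * Real.pi * poissonKernel t z : ℝ) : ℂ) := by
  have hi : Integrable fun x : ℝ => ((Real.exp (-(t * |x|)) : ℝ) : ℂ) *
      Complex.exp (-(Complex.I * ((x * z : ℝ) : ℂ))) :=
    integrable_mul_kernel (integrable_exp_neg_mul_abs ht).ofReal z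
  rw [ft, ← intervalIntegral.integral_Iic_add_Ioi (b := 0) hi.integrableOn hi.integrableOn]
  have e1 : ∫ x in Iic (0 : ℝ), ((Real.exp (-(t * |x|)) : ℝ) : ℂ) *
      Complex.exp (-(Complex.I * ((x * z : ℝ) : ℂ))) =
      ∫ x in Iic (0 : ℝ), Complex.exp ((t - Complex.I * z) * x) := by
    refine setIntegral_congr_fun measurableSet_Iic fun x hx => ?_
    simp only [abs_of_nonpos (mem_Iic.1 hx)]
    rw [Complex.ofReal_exp, ← Complex.exp_add]
    congr 1; push_cast; ring
  have e2 : ∫ x in Ioi (0 : ℝ), ((Real.exp (-(t * |x|)) : ℝ) : ℂ) *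
      Complex.exp (-(Complex.I * ((x * z : ℝ) : ℂ))) =
      ∫ x in Ioi (0 : ℝ), Complex.exp ((-t - Complex.I * z) * x) := by
    refine setIntegral_congr_fun measurableSet_Ioi fun x hx => ?_
    simp only [abs_of_pos (mem_Ioi.1 hx)]
    rw [Complex.ofReal_exp, ← Complex.exp_add]
    congr 1; push_cast; ring
  rw [e1, e2, integral_exp_mul_complex_Iic (by simpa using ht),
    integral_exp_mul_complex_Ioi (by simpa using ht)]
  have n1 : (t : ℂ) - Complex.I * z ≠ 0 := fun h => by
    have := congrArg Complex.re h
    simp at this; exact ht.ne' this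
  have n2 : -(t : ℂ) - Complex.I * z ≠ 0 := fun h => by
    have := congrArg Complex.re h
    simp at this; exact ht.ne' this
  have n3 : (z : ℂ) ^ 2 + t ^ 2 ≠ 0 := by
    have : z ^ 2 + t ^ 2 ≠ 0 := by positivity
    exact_mod_cast this
  have n4 : (Real.pi : ℂ) ≠ 0 := by exact_mod_cast Real.pi_ne_zero
  rw [poissonKernel]
  push_cast
  simp only [mul_zero, Complex.exp_zero]
  rw [div_add_div _ _ n1 n2, ← mul_assoc, mul_assoc 2, mul_one_div_cancel n4, mul_one,
    mul_div_assoc', div_eq_div_iff (mul_ne_zero n1 n2) n3]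
  linear_combination (-2 * t * z ^ 2 : ℂ) * Complex.I_sq

theorem integrable_poissonKernel {t : ℝ} (ht : 0 < t) : Integrable (poissonKernel t) := by
  have := ProbabilityTheory.integrable_cauchyPDFReal 0 (γ := t.toNNReal)
  refine this.congr (Eventually.of_forall fun u => ?_)
  rw [ProbabilityTheory.cauchyPDFReal_def, poissonKernel, sub_zero, one_div, div_eq_mul_inv, mul_assoc,
    Real.coe_toNNReal t ht.le]

theorem ft_poissonKernel {t : ℝ} (ht : 0 < t) (x : ℝ) :
    ft (fun u => (poissonKernel t u : ℂ)) x = (Real.exp (-(t * |x|)) : ℝ) := by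
  set φ : ℝ → ℂ := fun x => (Real.exp (-(t * |x|)) : ℂ) with hφ
  have hφc : Continuous φ := by rw [hφ]; fun_prop
  have hφi : Integrable φ := (integrable_exp_neg_mul_abs ht).ofReal
  have h2 : (2 * Real.pi) ≠ 0 := by positivity
  have hF : ∀ w, FourierTransform.fourier φ w =
      ((2 * Real.pi * poissonKernel t (w * (2 * Real.pi)) : ℝ) : ℂ) := by
    intro w
    rw [← ft_exp_neg_mul_abs ht, ft_eq_fourier, mul_inv_cancel_right₀ h2]
  have hFi : Integrable (FourierTransform.fourier φ) := by
    have h1 := (((integrable_poissonKernel ht).comp_mul_right' h2).const_mul (2 * Real.pi)).ofReal (𝕜 := ℂ)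
    exact h1.congr (Eventually.of_forall fun w => (hF w).symm)
  -- Inversion is evaluated at `-x` because the inverse kernel has the opposite sign; `φ` is even.
  have hinv := congrFun (hφc.fourierInv_fourier_eq hφi hFi) (-x)
  rw [Real.fourierInv_eq'] at hinv
  have e : (Real.exp (-(t * |x|)) : ℂ) = φ (-x) := by simp [hφ]
  rw [Complex.ofReal_exp] at *
  rw [ft, ← Complex.ofReal_exp]
  rw [show ((Real.exp (-(t * |x|)) : ℝ) : ℂ) = φ (-x) by simp [hφ], ← hinv]
  have h3 := Measure.integral_comp_mul_right (fun u => (poissonKernel t u : ℂ) *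
    Complex.exp (-(Complex.I * ((u * x : ℝ) : ℂ)))) (2 * Real.pi)
  rw [abs_of_pos (by positivity), eq_inv_smul_iff₀ h2] at h3
  rw [← h3, ← integral_smul]
  congr 1; ext w
  rw [hF, smul_eq_mul, Complex.real_smul]
  have e5 : -(Complex.I * ((w * (2 * Real.pi) * x : ℝ) : ℂ)) =
      ((2 * Real.pi * inner ℝ w (-x) : ℝ) : ℂ) * Complex.I := by
    simp; ring
  rw [e5]
  push_cast; ring

theorem isTranslationKernel_poisson :
    IsTranslationKernel poissonKernel fun t x => Real.exp (-(t * |x|)) where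
  measurable := by
    unfold poissonKernel Function.uncurry
    fun_prop
  nonneg t ht u := by unfold poissonKernel; positivity
  bdd t ht := by
    refine ⟨1 / Real.pi * (t / t ^ 2), fun u => ?_⟩
    unfold poissonKernel
    gcongr
    nlinarith [sq_nonneg u]
  integrable t ht := integrable_poissonKernel ht
  integral_eq_one t ht := integral_eq_of_ft_zero (by rw [ft_poissonKernel ht]; simp)
  ft_eq t ht x := ft_poissonKernel ht x
  mult_neg t x := by simp
  mult_nonneg t x := (Real.exp_pos _).le
  mult_le_one t ht x := Real.exp_le_one_iff.2 (neg_nonpos.2 (by positivity))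
  mult_zero x := by simp
  mult_continuous t := by fun_prop
  mult_lipschitz R := by
    refine ⟨|R|, by positivity, fun s t hs ht x hx => ?_⟩
    refine (abs_exp_neg_sub_exp_neg_le (by positivity) (by positivity)).trans ?_
    rw [← sub_mul, abs_mul, abs_abs, mul_comm]
    exact mul_le_mul_of_nonneg_right (hx.trans (le_abs_self R)) (abs_nonneg _)
  mult_decay t ht := by
    refine ⟨1 / t, by positivity, fun x hx => exp_neg_le_half ?_⟩
    rw [div_lt_iff₀ ht] at hx
    linarith
  mult_sq := by
    refine ⟨1, by norm_num, fun t ht => ?_⟩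
    have e : ∀ x : ℝ, Real.exp (-(t * |x|)) ^ 2 = Real.exp (-(2 * t * |x|)) := by
      intro x
      rw [pow_two, ← Real.exp_add]; congr 1; ring
    have hs : (0 : ℝ) ≤ t ^ (-(1 / 2) : ℝ) := by positivity
    -- Here the `L²` norm is exactly `t ^ (-1/2)`, which dictates the exponent in `mult_sq`.
    refine eLpNorm_two_le (I := t⁻¹) (by fun_prop) ?_ ?_ ?_ (by positivity)
    · simp_rw [e]
      exact integrable_exp_neg_mul_abs (by positivity)
    · simp_rw [e]
      rw [integral_comp_abs (f := fun x => Real.exp (-(2 * t * x)))]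
      simp_rw [← neg_mul]
      rw [integral_exp_mul_Ioi (by linarith)]
      apply le_of_eq
      simp
      field_simp
    · have : t⁻¹ = t ^ (-(1 / 2) : ℝ) * t ^ (-(1 / 2) : ℝ) := by
        rw [← Real.rpow_add ht, ← Real.rpow_neg_one]; norm_num
      rw [this]; nlinarith

/-! ### Even functions -/

/-- The triangle inequality over the two half-lines; the factor 2 is not sharp but covers `p = ∞` as
well. -/
theorem eLpNorm_le_two_mul_of_even {p : ℝ≥0∞} (hp : 1 ≤ p) {g : ℝ → ℂ}
    (hg : AEStronglyMeasurable g) (heven : ∀ x, g (-x) = g x) :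
    eLpNorm g p ≤ 2 * eLpNorm g p halfLine := by
  have h1 : eLpNorm ((Iio 0)ᶜ.indicator g) p = eLpNorm g p halfLine := by
    rw [eLpNorm_indicator_eq_eLpNorm_restrict measurableSet_Iio.compl, compl_Iio, halfLine,
      Measure.restrict_congr_set Ioi_ae_eq_Ici]
  have h2 : eLpNorm ((Iio 0).indicator g) p = eLpNorm g p halfLine := by
    have e2 : (Iio (0 : ℝ)).indicator g = (Ioi 0).indicator g ∘ Neg.neg := by
      ext x
      simp only [Function.comp_apply, indicator, mem_Iio, mem_Ioi, Left.neg_pos_iff, heven]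
    rw [e2, eLpNorm_comp_measurePreserving (hg.indicator measurableSet_Ioi)
      (Measure.measurePreserving_neg volume), eLpNorm_indicator_eq_eLpNorm_restrict measurableSet_Ioi]
  have h3 := eLpNorm_add_le (μ := volume) (hg.indicator (measurableSet_Iio (a := (0 : ℝ))))
    (hg.indicator (measurableSet_Iio (a := (0 : ℝ))).compl) hp
  rwa [indicator_self_add_compl, h1, h2, ← two_mul] at h3

theorem evenExt_neg (f : ℝ → ℂ) (x : ℝ) : evenExt f (-x) = evenExt f x := by
  rw [evenExt, evenExt, abs_neg]

theorem measurable_evenExt {f : ℝ → ℂ} (hf : Measurable f) : Measurable (evenExt f) :=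
  hf.comp measurable_norm

theorem evenExt_ae_eq (f : ℝ → ℂ) : evenExt f =ᵐ[halfLine] f := by
  filter_upwards [ae_restrict_mem measurableSet_Ioi] with x hx
  rw [evenExt, abs_of_pos hx]

theorem eLpNorm_evenExt_le {p : ℝ≥0∞} (hp : 1 ≤ p) {f : ℝ → ℂ} (hf : Measurable f) :
    eLpNorm (evenExt f) p ≤ 2 * eLpNorm f p halfLine := by
  rw [← eLpNorm_congr_ae (evenExt_ae_eq f)]
  exact eLpNorm_le_two_mul_of_even hp (measurable_evenExt hf).aestronglyMeasurable (evenExt_neg f)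

theorem eLpNorm_evenExt_restrict_le {p : ℝ≥0∞} (hp : 1 ≤ p) {f : ℝ → ℂ} (hf : Measurable f) (R : ℝ) :
    eLpNorm (evenExt f) p (volume.restrict {x | R < |x|}) ≤
      2 * eLpNorm f p (halfLine.restrict {x | R < |x|}) := by
  have hS : MeasurableSet {x : ℝ | R < |x|} := measurableSet_lt (by fun_prop) (by fun_prop)
  rw [← eLpNorm_congr_ae (ae_restrict_of_ae (evenExt_ae_eq f)),
    ← eLpNorm_indicator_eq_eLpNorm_restrict hS, ← eLpNorm_indicator_eq_eLpNorm_restrict hS]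
  refine eLpNorm_le_two_mul_of_even hp ((measurable_evenExt hf).indicator hS).aestronglyMeasurable
    fun x => ?_
  simp only [indicator, mem_ofPred_eq, abs_neg, evenExt_neg]

theorem memLp_evenExt {p : ℝ≥0∞} (hp : 1 ≤ p) (f : Lp ℂ p halfLine) : MemLp (evenExt f) p := by
  have hf : Measurable f := (Lp.stronglyMeasurable f).measurable
  exact ⟨(measurable_evenExt hf).aestronglyMeasurable, (eLpNorm_evenExt_le hp hf).trans_lt
    (ENNReal.mul_lt_top (by simp) (Lp.memLp f).2)⟩

theorem kernelTranslation_even {k : ℝ → ℝ → ℝ} (hk : ∀ t u, k t (-u) = k t u) {g : ℝ → ℂ}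
    (hg : ∀ x, g (-x) = g x) (t x : ℝ) :
    kernelTranslation k t g (-x) = kernelTranslation k t g x := by
  rw [kernelTranslation, kernelTranslation, hg, ← integral_neg_eq_self]
  congr 2; ext ξ
  rw [hg, ← hk, neg_sub, sub_neg_eq_add, neg_add_eq_sub, ← hk, neg_sub]

theorem poissonKernel_neg (t u : ℝ) : poissonKernel t (-u) = poissonKernel t u := by
  rw [poissonKernel, poissonKernel, neg_sq]

/-! ### Cosine transforms -/

/-- For even `g` the values at `z` and `-z` coincide; averaging them leaves the cosine. -/
theorem ft_trunc_eq_integral_cos {p : ℝ≥0∞} (hp : 1 ≤ p) {g : ℝ → ℂ} (hg : MemLp g p)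
    (heven : ∀ x, g (-x) = g x) {N : ℝ} (hN : 0 ≤ N) (z : ℝ) :
    ft (trunc N g) z = ∫ x in (-N)..N, g x * ((Real.cos (x * z) : ℝ) : ℂ) := by
  have hgi : IntervalIntegrable g volume (-N) N := by
    rw [intervalIntegrable_iff_integrableOn_Ioc_of_le (by linarith)]
    exact (hg.restrict _).integrable hp
  have hi : ∀ w : ℝ, IntervalIntegrable (fun x => g x * Complex.exp (-(Complex.I * ((x * w : ℝ) : ℂ))))
      volume (-N) N := fun w => hgi.mul_continuousOn (by fun_prop)
  have h1 : ft (trunc N g) z = ft (trunc N g) (-z) := by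
    rw [ft_trunc hN, ft_trunc hN]
    have := intervalIntegral.integral_comp_neg (a := -N) (b := N)
      (fun x => g x * Complex.exp (-(Complex.I * ((x * z : ℝ) : ℂ))))
    rw [neg_neg] at this
    rw [← this]
    congr 1; ext x
    rw [heven, neg_mul, mul_neg]
  have h2 : ft (trunc N g) z = (ft (trunc N g) z + ft (trunc N g) (-z)) / 2 := by
    rw [← h1]; ring
  rw [h2, ft_trunc hN, ft_trunc hN, ← intervalIntegral.integral_add (hi z) (hi (-z)),
    ← intervalIntegral.integral_div]
  congr 1; ext x
  rw [Complex.ofReal_cos, Complex.cos]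
  have e1 : -(Complex.I * ((x * z : ℝ) : ℂ)) = -((x * z : ℝ) : ℂ) * Complex.I := by ring
  have e2 : -(Complex.I * ((x * -z : ℝ) : ℂ)) = ((x * z : ℝ) : ℂ) * Complex.I := by push_cast; ring
  rw [e1, e2]; ring

theorem isTransform_cos_iff {p q : ℝ≥0∞} (hp : 1 ≤ p) (f : Lp ℂ p halfLine) (F : Lp ℂ q halfLine) :
    IsCosineTransform f F ↔
      Tendsto (fun N : ℝ => eLpNorm ((F : ℝ → ℂ) - ft (trunc N (evenExt f))) q halfLine) atTop (𝓝 0) := by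
  apply tendsto_congr'
  filter_upwards [eventually_ge_atTop 0] with N hN
  congr 1; ext z
  rw [Pi.sub_apply, ft_trunc_eq_integral_cos hp (memLp_evenExt hp f) (evenExt_neg f) hN]

theorem ft_trunc_neg {p : ℝ≥0∞} (hp : 1 ≤ p) {g : ℝ → ℂ} (hg : MemLp g p)
    (heven : ∀ x, g (-x) = g x) {N : ℝ} (hN : 0 ≤ N) (z : ℝ) :
    ft (trunc N g) (-z) = ft (trunc N g) z := by
  simp_rw [ft_trunc_eq_integral_cos hp hg heven hN, mul_neg, Real.cos_neg]

/-- This reduces the half-line case to the line: the even extension of the cosine transform is the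
Fourier transform of the even extension. -/
theorem IsCosineTransform.hasFT {p q : ℝ≥0∞} (hp : 1 ≤ p) (hq : 1 ≤ q) {f : Lp ℂ p halfLine}
    {F : Lp ℂ q halfLine} (h : IsCosineTransform f F) : HasFT q (evenExt f) (evenExt F) := by
  rw [isTransform_cos_iff hp] at h
  have h2 := tendsto_const_mul_zero (c := 2) (by norm_num) h
  refine tendsto_of_tendsto_of_tendsto_of_le_of_le' tendsto_const_nhds h2
    (Eventually.of_forall fun N => zero_le) ?_
  filter_upwards [eventually_ge_atTop 0] with N hN
  have hf := memLp_evenExt hp f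
  have hF := measurable_evenExt (Lp.stronglyMeasurable F).measurable
  have e : eLpNorm ((F : ℝ → ℂ) - ft (trunc N (evenExt f))) q halfLine =
      eLpNorm (evenExt F - ft (trunc N (evenExt f))) q halfLine := by
    apply eLpNorm_congr_ae
    filter_upwards [evenExt_ae_eq F] with x hx
    rw [Pi.sub_apply, Pi.sub_apply, hx]
  rw [e]
  refine eLpNorm_le_two_mul_of_even hq
    (hF.aestronglyMeasurable.sub (continuous_ft (integrable_trunc hp hf N)).aestronglyMeasurable) ?_
  intro x
  rw [Pi.sub_apply, Pi.sub_apply, evenExt_neg, ft_trunc_neg hp hf (evenExt_neg f) hN]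

/-! ### Existence and uniqueness of the transforms -/

theorem eq_of_tendsto_eLpNorm_sub {q : ℝ≥0∞} (hq : 1 ≤ q) {μ : Measure ℝ} {F F' : Lp ℂ q μ}
    {G : ℝ → ℝ → ℂ} (hG : ∀ N, AEStronglyMeasurable (G N) μ)
    (h : Tendsto (fun N => eLpNorm ((F : ℝ → ℂ) - G N) q μ) atTop (𝓝 0))
    (h' : Tendsto (fun N => eLpNorm ((F' : ℝ → ℂ) - G N) q μ) atTop (𝓝 0)) : F = F' := by
  have h0 : eLpNorm ((F : ℝ → ℂ) - (F' : ℝ → ℂ)) q μ ≤ 0 := by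
    have := h.add h'
    rw [add_zero] at this
    refine ge_of_tendsto' this fun N => ?_
    have e : (F : ℝ → ℂ) - (F' : ℝ → ℂ) = ((F : ℝ → ℂ) - G N) - ((F' : ℝ → ℂ) - G N) := by ring
    rw [e]
    exact eLpNorm_sub_le ((Lp.aestronglyMeasurable F).sub (hG N))
      ((Lp.aestronglyMeasurable F').sub (hG N)) hq
  have h1 := (eLpNorm_eq_zero_iff ((Lp.aestronglyMeasurable F).sub (Lp.aestronglyMeasurable F'))
    (zero_lt_one.trans_le hq).ne').1 (nonpos_iff_eq_zero.1 h0)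
  apply Lp.ext
  filter_upwards [h1] with x hx
  exact sub_eq_zero.1 hx

variable {p q C : ℝ≥0∞}

theorem HausdorffYoung.existsUnique_isFourierTransform (H : HausdorffYoung p q C)
    (f : Lp ℂ p (volume : Measure ℝ)) :
    ∃! F : Lp ℂ q (volume : Measure ℝ), IsFourierTransform f F := by
  obtain ⟨F, hF⟩ := H.exists_hasFT (Lp.memLp f)
  refine ⟨F, (isTransform_iff_hasFT _ _).2 hF, fun F' hF' => ?_⟩
  exact eq_of_tendsto_eLpNorm_sub H.one_le_conj
    (fun N => (continuous_ft (integrable_trunc H.one_le (Lp.memLp f) N)).aestronglyMeasurable)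
    ((isTransform_iff_hasFT _ _).1 hF') hF

theorem HausdorffYoung.existsUnique_isCosineTransform (H : HausdorffYoung p q C)
    (f : Lp ℂ p halfLine) : ∃! F : Lp ℂ q halfLine, IsCosineTransform f F := by
  have hf := memLp_evenExt H.one_le f
  obtain ⟨F, hF⟩ := H.exists_hasFT hf
  have hFm : MemLp F q halfLine := (Lp.memLp F).restrict _
  -- The candidate is the restriction to the half-line of the transform of the even extension.
  have hG : IsCosineTransform f (hFm.toLp F) := by
    rw [isTransform_cos_iff H.one_le]
    refine tendsto_of_tendsto_of_tendsto_of_le_of_le tendsto_const_nhds hF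
      (fun N => zero_le) fun N => ?_
    refine le_trans (le_of_eq (eLpNorm_congr_ae ?_))
      (eLpNorm_mono_measure _ (Measure.restrict_le_self (s := Ioi 0)))
    filter_upwards [hFm.coeFn_toLp] with x hx
    rw [Pi.sub_apply, Pi.sub_apply, hx]
  refine ⟨_, hG, fun F' hF' => ?_⟩
  exact eq_of_tendsto_eLpNorm_sub H.one_le_conj
    (fun N => (continuous_ft (integrable_trunc H.one_le hf N)).aestronglyMeasurable)
    ((isTransform_cos_iff H.one_le _ _).1 hF') ((isTransform_cos_iff H.one_le _ _).1 hG)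

/-! ### The averaging measures -/

theorem integrableOn_one_add_rpow (a : ℝ) :
    IntegrableOn (fun t : ℝ => 1 + t ^ (-(1 / 2) : ℝ)) (Ioo 0 a) := by
  rcases le_or_gt a 0 with ha | ha
  · rw [Ioo_eq_empty (not_lt.2 ha)]
    exact integrableOn_empty
  · have h : IntervalIntegrable (fun t : ℝ => 1 + t ^ (-(1 / 2) : ℝ)) volume 0 a :=
      intervalIntegrable_const.add (intervalIntegral.intervalIntegrable_rpow' (by norm_num))
    rw [intervalIntegrable_iff_integrableOn_Ioc_of_le ha.le] at h
    exact h.mono_set Ioo_subset_Ioc_self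

/-- On `(0, a)` the density `√t` is at most `√a`, so Lebesgue measure dominates. -/
theorem integrableOn_one_add_rpow_sqrtMeasure (a : ℝ) :
    IntegrableOn (fun t : ℝ => 1 + t ^ (-(1 / 2) : ℝ)) (Ioo 0 a) sqrtMeasure := by
  have hle : sqrtMeasure.restrict (Ioo 0 a) ≤
      ENNReal.ofReal (Real.sqrt a) • volume.restrict (Ioo 0 a) := by
    rw [sqrtMeasure, restrict_withDensity measurableSet_Ioo, ← withDensity_const]
    apply withDensity_mono
    filter_upwards [ae_restrict_mem measurableSet_Ioo] with t ht
    exact ENNReal.ofReal_le_ofReal (Real.sqrt_le_sqrt ht.2.le)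
  exact ((integrableOn_one_add_rpow a).smul_measure ENNReal.ofReal_ne_top).mono_measure hle

/-! ### The theorem for each of the two translations -/

theorem exists_eLpNorm_le_of_isBounded {μ : Measure ℝ} [Fact (1 ≤ p)] {K : Set (Lp ℂ p μ)}
    (hK : Bornology.IsBounded K) : ∃ B : ℝ≥0∞, B ≠ ∞ ∧ ∀ f ∈ K, eLpNorm f p μ ≤ B := by
  obtain ⟨B, hB⟩ := hK.exists_norm_le
  refine ⟨ENNReal.ofReal B, ENNReal.ofReal_ne_top, fun f hf => ?_⟩
  rw [← ENNReal.ofReal_toReal (Lp.eLpNorm_ne_top f), ← Lp.norm_def]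
  exact ENNReal.ofReal_le_ofReal (hB f hf)

theorem kernelTranslation_zero (k : ℝ → ℝ → ℝ) (f : ℝ → ℂ) : kernelTranslation k 0 f = f := by
  ext x; rw [kernelTranslation, if_pos rfl]

namespace HausdorffYoung

theorem heat (H : HausdorffYoung p q C) [Fact (1 ≤ p)] {b : ℝ} (hb : 0 < b)
    {K : Set (Lp ℂ p (volume : Measure ℝ))} (hK : Bornology.IsBounded K) :
    (Equivanishing K → PropB1 (heatTranslation b) (fourierImage q K) ∧
      PropB2 (heatTranslation b) volume univ (fourierImage q K)) ∧
    (PropB1 (heatTranslation b) K → Equivanishing (fourierImage q K)) := by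
  have hk := isTranslationKernel_heat hb
  obtain ⟨B, hB, hKB⟩ := exists_eLpNorm_le_of_isBounded hK
  rw [heatTranslation_eq]
  set K' : Set (ℝ → ℂ) := (fun f : Lp ℂ p (volume : Measure ℝ) => (f : ℝ → ℂ)) '' K
  have hmem : ∀ f ∈ K', MemLp f p := by
    rintro _ ⟨f, hf, rfl⟩; exact Lp.memLp f
  have hbd : ∀ f ∈ K', eLpNorm f p ≤ B := by
    rintro _ ⟨f, hf, rfl⟩; exact hKB f hf
  refine ⟨fun hE => ?_, fun hP => ?_⟩
  · have hE' : EquivanishingOn p K' := by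
      intro ε hε
      obtain ⟨R, hR, h⟩ := hE ε hε
      refine ⟨R, hR, ?_⟩
      rintro _ ⟨f, hf, rfl⟩
      exact h f hf
    refine ⟨?_, ?_⟩
    · intro ε hε M _
      obtain ⟨δ, hδ, h⟩ := hk.exists_eLpNorm_translation_sub_lt H hmem hB hbd hE' hε
      refine ⟨δ, hδ, fun t ht _ r hr htr F hF => ?_⟩
      obtain ⟨f, hf, hfF⟩ := hF
      exact h (t + r) t htr ht (by simpa using hr) f ⟨f, hf, rfl⟩ F (Lp.aestronglyMeasurable F)
        ((isTransform_iff_hasFT _ _).1 hfF)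
    · intro a _ R _ ε hε
      obtain ⟨δ, hδ, h⟩ := hk.exists_norm_translationMean_sub_lt H hmem hB hbd hE'
        (integrableOn_one_add_rpow a) R hε
      refine ⟨δ, hδ, fun r hr F hF x _ _ hx hxr => ?_⟩
      obtain ⟨f, hf, hfF⟩ := hF
      exact h r hr f ⟨f, hf, rfl⟩ F (Lp.stronglyMeasurable F).measurable
        ((isTransform_iff_hasFT _ _).1 hfF) x hx hxr
  · intro ε hε
    obtain ⟨η, hη, h⟩ := hk.exists_eLpNorm_restrict_lt H hε
    -- Only the comparison of `T^δ f` with `T^0 f = f` is used, so any positive time bound will do.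
    obtain ⟨δ, hδ, hP⟩ := hP η hη 1 one_pos
    obtain ⟨R, hR, h⟩ := h δ hδ
    refine ⟨R, hR, fun F hF => ?_⟩
    obtain ⟨f, hf, hfF⟩ := hF
    refine h f F (Lp.stronglyMeasurable f).measurable (Lp.memLp f) (Lp.aestronglyMeasurable F)
      ((isTransform_iff_hasFT _ _).1 hfF) ?_
    have := hP 0 le_rfl one_pos δ (abs_of_pos hδ).le (by linarith) f hf
    rwa [kernelTranslation_zero, zero_add] at this

theorem harmonic (H : HausdorffYoung p q C) [Fact (1 ≤ p)]
    {K : Set (Lp ℂ p halfLine)} (hK : Bornology.IsBounded K) :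
    (Equivanishing K → PropB1 evenHarmonicTranslation (cosineImage q K) ∧
      PropB2 evenHarmonicTranslation volume (Ioi 0) (cosineImage q K) ∧
      PropB2 evenHarmonicTranslation sqrtMeasure (Ioi 0) (cosineImage q K)) ∧
    (PropB1 evenHarmonicTranslation K → Equivanishing (cosineImage q K)) := by
  have hk := isTranslationKernel_poisson
  have hq := H.one_le_conj
  obtain ⟨B, hB, hKB⟩ := exists_eLpNorm_le_of_isBounded hK
  have hT : evenHarmonicTranslation = fun t f => kernelTranslation poissonKernel t (evenExt f) := by
    ext t f x
    rw [evenHarmonicTranslation, harmonicTranslation_eq]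
  have hhalf : ∀ ε : ℝ, 2 * ENNReal.ofReal (ε / 2) = ENNReal.ofReal ε := fun ε => by
    rw [← ENNReal.ofReal_ofNat, ← ENNReal.ofReal_mul (by norm_num)]
    congr 1; ring
  set K' : Set (ℝ → ℂ) := (fun f : Lp ℂ p halfLine => evenExt f) '' K
  have hmem : ∀ f ∈ K', MemLp f p := by
    rintro _ ⟨f, hf, rfl⟩; exact memLp_evenExt H.one_le f
  have hbd : ∀ f ∈ K', eLpNorm f p ≤ 2 * B := by
    rintro _ ⟨f, hf, rfl⟩
    refine (eLpNorm_evenExt_le H.one_le (Lp.stronglyMeasurable f).measurable).trans ?_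
    gcongr
    exact hKB f hf
  have hB2 : 2 * B ≠ ∞ := ENNReal.mul_ne_top (by norm_num) hB
  have hFm : ∀ F : Lp ℂ q halfLine, Measurable (evenExt F) := fun F =>
    measurable_evenExt (Lp.stronglyMeasurable F).measurable
  refine ⟨fun hE => ?_, fun hP => ?_⟩
  · have hE' : EquivanishingOn p K' := by
      intro ε hε
      obtain ⟨R, hR, h⟩ := hE (ε / 2) (half_pos hε)
      refine ⟨R, hR, ?_⟩
      rintro _ ⟨f, hf, rfl⟩
      refine (eLpNorm_evenExt_restrict_le H.one_le (Lp.stronglyMeasurable f).measurable R).trans_lt ?_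
      rw [← hhalf]
      exact ENNReal.mul_lt_mul_right (by norm_num) (by norm_num) (h f hf)
    have hB2' : ∀ ν : Measure ℝ,
        (∀ a, IntegrableOn (fun t : ℝ => 1 + t ^ (-(1 / 2) : ℝ)) (Ioo 0 a) ν) →
        PropB2 evenHarmonicTranslation ν (Ioi 0) (cosineImage q K) := by
      intro ν hν a _ R _ ε hε
      obtain ⟨δ, hδ, h⟩ := hk.exists_norm_translationMean_sub_lt H hmem hB2 hbd hE' (hν a) R hε
      refine ⟨δ, hδ, fun r hr F hF x _ _ hx hxr => ?_⟩
      obtain ⟨f, hf, hfF⟩ := hF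
      rw [hT]
      exact h r hr _ ⟨f, hf, rfl⟩ _ (hFm F) (hfF.hasFT H.one_le hq) x hx hxr
    refine ⟨?_, hB2' _ integrableOn_one_add_rpow, hB2' _ integrableOn_one_add_rpow_sqrtMeasure⟩
    intro ε hε M _
    obtain ⟨δ, hδ, h⟩ := hk.exists_eLpNorm_translation_sub_lt H hmem hB2 hbd hE' hε
    refine ⟨δ, hδ, fun t ht _ r hr htr F hF => ?_⟩
    obtain ⟨f, hf, hfF⟩ := hF
    rw [hT]
    exact (eLpNorm_mono_measure _ Measure.restrict_le_self).trans_lt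
      (h (t + r) t htr ht (by simpa using hr) _ ⟨f, hf, rfl⟩ _ (hFm F).aestronglyMeasurable
        (hfF.hasFT H.one_le hq))
  · intro ε hε
    obtain ⟨η, hη, h⟩ := hk.exists_eLpNorm_restrict_lt H hε
    -- Halving pays for the factor 2 in passing from the half-line to the line.
    obtain ⟨δ, hδ, hP⟩ := hP (η / 2) (half_pos hη) 1 one_pos
    obtain ⟨R, hR, h⟩ := h δ hδ
    refine ⟨R, hR, fun F hF => ?_⟩
    obtain ⟨f, hf, hfF⟩ := hF
    have hfm : Measurable (evenExt f) := measurable_evenExt (Lp.stronglyMeasurable f).measurable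
    have hlt : eLpNorm (fun x => kernelTranslation poissonKernel δ (evenExt f) x - evenExt f x) p <
        ENNReal.ofReal η := by
      have := hP 0 le_rfl one_pos δ (abs_of_pos hδ).le (by linarith) f hf
      rw [hT] at this
      dsimp only at this
      rw [kernelTranslation_zero, zero_add] at this
      refine (eLpNorm_le_two_mul_of_even H.one_le
        ((hk.measurable_kernelTranslation_right hδ hfm).sub hfm).aestronglyMeasurable
        fun x => ?_).trans_lt ?_
      · rw [Pi.sub_apply, Pi.sub_apply, evenExt_neg,
          kernelTranslation_even poissonKernel_neg (evenExt_neg f)]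
      · rw [← hhalf]
        exact ENNReal.mul_lt_mul_right (by norm_num) (by norm_num) this
    have h1 := h (evenExt f) (evenExt F) hfm (memLp_evenExt H.one_le f) (hFm F).aestronglyMeasurable
      (hfF.hasFT H.one_le hq) hlt
    refine lt_of_le_of_lt ?_ h1
    rw [← eLpNorm_congr_ae (ae_restrict_of_ae (evenExt_ae_eq F))]
    exact eLpNorm_mono_measure _ (Measure.restrict_mono_measure Measure.restrict_le_self _)

end HausdorffYoung

end Pego

theorem mainTheorem3 (p q : ℝ≥0∞) [Fact (1 ≤ p)] (hp : p ≤ 2) (hpq : p⁻¹ + q⁻¹ = 1) :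
    -- harmonic translation and cosine transform
    ((∀ f : Lp ℂ p Pego.halfLine, ∃! F : Lp ℂ q Pego.halfLine, Pego.IsCosineTransform f F) ∧
      ∀ K : Set (Lp ℂ p Pego.halfLine), Bornology.IsBounded K →
        (Pego.Equivanishing K →
          Pego.PropB1 Pego.evenHarmonicTranslation (Pego.cosineImage q K) ∧
          Pego.PropB2 Pego.evenHarmonicTranslation volume (Ioi 0) (Pego.cosineImage q K) ∧
          Pego.PropB2 Pego.evenHarmonicTranslation Pego.sqrtMeasure (Ioi 0)
            (Pego.cosineImage q K)) ∧
        (Pego.PropB1 Pego.evenHarmonicTranslation K →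
          Pego.Equivanishing (Pego.cosineImage q K))) ∧
    -- heat translation and Fourier transform
    ((∀ f : Lp ℂ p (volume : Measure ℝ), ∃! F : Lp ℂ q (volume : Measure ℝ),
        Pego.IsFourierTransform f F) ∧
      ∀ b : ℝ, 0 < b → ∀ K : Set (Lp ℂ p (volume : Measure ℝ)), Bornology.IsBounded K →
        (Pego.Equivanishing K →
          Pego.PropB1 (Pego.heatTranslation b) (Pego.fourierImage q K) ∧
          Pego.PropB2 (Pego.heatTranslation b) volume univ (Pego.fourierImage q K)) ∧
        (Pego.PropB1 (Pego.heatTranslation b) K →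
          Pego.Equivanishing (Pego.fourierImage q K))) := by
  have hp1 : 1 ≤ p := Fact.out
  obtain ⟨C, hC, hCf⟩ := Pego.exists_eLpNorm_ft_le hp1 hp hpq
  have H : Pego.HausdorffYoung p q C := ⟨hp1, hp, ENNReal.holderConjugate_iff.2 hpq, hC, hCf⟩
  exact ⟨⟨H.existsUnique_isCosineTransform, fun K hK => H.harmonic hK⟩,
    H.existsUnique_isFourierTransform, fun b hb K hK => H.heat hb hK⟩
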